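/- **Setting.** Fix a countably infinite set of proposition letters. An LTS is $\mathbb S=\langle T,R,\kappa,s_I\rangle$ with $R\subseteq T^2$, $s_I\in T$ and $\kappa$ assigning a set of letters to every node; $\mathbb S[p\mapsto X]$ is $\mathbb S$ with the letter $p$ reinterpreted as $X\subseteq T$, and $\mathbb S.w$ is $\mathbb S$ with distinguished node $w$. *One-step languages.* $\mathrm{FOE}_1(A)$ is the set of first-order sentences with equality over the monadic predicates $A$, built from $a(x),\neg a(x),x\approx y,x\not\approx y$ with $\vee,\wedge,\exists,\forall$; $\mathrm{FOE}^\infty_1(A)$ has in addition $\exists^\infty x$ ("infinitely many") and $\forall^\infty x$ ("all but finitely many"). In the empty domain, $\exists x.\alpha$ and $\exists^\infty x.\alpha$ are false and $\forall x.\alpha$ and $\forall^\infty x.\alpha$ are true. $L_1^+$ is the set of sentences without negated predicates. The $B$-continuous sentences of $\mathrm{FOE}^\infty_1$ are the sentences generated by $b(x)\mid\psi\mid\alpha\wedge\alpha\mid\alpha\vee\alpha\mid\exists x.\alpha\mid \forall x(\alpha\vee\psi)\wedge\forall^\infty x.\psi$, where $b\in B$ and $\psi$ is a positive formula without predicates from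 $B$; the $B$-cocontinuous sentences are those whose boolean dual is $B$-continuous. *$\mu$-calculi.* For $L_1\in\{\mathrm{FOE}_1,\mathrm{FOE}_1^\infty\}$, $\mu L_1$ is generated by $q\mid\neg q\mid\varphi\vee\varphi\mid\varphi\wedge\varphi\mid\bigcirc_\alpha(\varphi_1,\dots,\varphi_n)\mid\mu p.\varphi\mid\nu p.\varphi$, with $\alpha(a_1,\dots,a_n)\in L_1^+$ and $p$ positive in $\varphi$; here $\bigcirc_\alpha(\overline\varphi)$ holds at $s$ iff $\alpha$ is true in the one-step model with domain $R[s]$ where $a_i$ denotes the set of successors of $s$ satisfying $\varphi_i$, and $\mu,\nu$ are least and greatest fixpoints. The formulas *noetherian in $Q$* are generated by $q\in Q$, $Q$-free $\mu L_1$-formulas, $\vee$, $\wedge$, $\bigcirc_\alpha$, and $\mu p.\varphi'$ with $\varphi'$ noetherian in $Q\cup\{p\}$. The formulas *continuous in $Q$* are generated in the same way (with $\varphi'$ continuous in $Q\cup\{p\}$), except that the modal clause is $\bigcirc_\alpha(\overline\varphi,\overline\psi)$ with $\overline\psi$ $Q$-free and $\alpha(\overline a,\overline b)$ $\overline a$-continuous.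 Co-noetherian and co-continuous formulas are defined dually (with $\nu$ for $\mu$ and cocontinuous $\alpha$). $\mu_DL_1$ (resp. $\mu_CL_1$) consists of the $\mu L_1$-formulas in which $\mu p.\varphi$ is formed only for $\varphi$ noetherian (resp. continuous) in $p$, and $\nu p.\varphi$ only for $\varphi$ co-noetherian (resp. co-continuous) in $p$. *Second-order logics.* One-sorted monadic second-order formulas are generated by $\Downarrow p\mid p\sqsubseteq q\mid R(p,q)\mid\neg\varphi\mid\varphi\vee\varphi\mid\exists p.\varphi$, no letter being both free and bound. Here $\Downarrow p$ says that $p$ denotes $\{s_I\}$, $p\sqsubseteq q$ is inclusion, and $R(p,q)$ says that every $p$-node has a successor that is a $q$-node. In $\mathrm{WMSO}$, $\exists p$ ranges over the finite subsets of $T$; in $\mathrm{NMSO}$, it ranges over the noetherian subsets. $X\subseteq T$ is *noetherian* if there is a bundle $B$ such that each $t\in X$ lies on a path in $B$; a *bundle* is a nonempty set of finite paths with a common starting point that contains no infinite chain strictly ascending in the initial-segment order. **Theorem.** 1. There is an effective (computable on Gödel numbers) translation $(\cdot)^*:\mu_D\mathrm{FOE}_1\to\mathrm{NMSO}$ such that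 the free letters of $\varphi^*$ are among those of $\varphi$ and, for every $\varphi\in\mu_D\mathrm{FOE}_1$ and every LTS $\mathbb S$, $\mathbb S\Vdash\varphi$ iff $\mathbb S\models\varphi^*$. Moreover, if $\mu p.\varphi\in\mu_D\mathrm{FOE}_1$, then $\mathbb S\models(\mu p.\varphi)^*$ iff there is a noetherian $X\subseteq T$ such that $s_I\in P$ for every $P\subseteq X$ with $\{w\in X\mid \mathbb S[p\mapsto P].w\models\varphi^*\}\subseteq P$. For the same translation all of this also holds when the bundles in the definition of noetherian sets are required to be closed under nonempty initial segments. 2. There is an effective translation $(\cdot)^*:\mu_C\mathrm{FOE}^\infty_1\to\mathrm{WMSO}$ such that the free letters of $\varphi^*$ are among those of $\varphi$ and, for every $\varphi\in\mu_C\mathrm{FOE}^\infty_1$ and every LTS $\mathbb S$, $\mathbb S\Vdash\varphi$ iff $\mathbb S\models\varphi^*$. Moreover, if $\mu p.\varphi\in\mu_C\mathrm{FOE}^\infty_1$, then $\mathbb S\models(\mu p.\varphi)^*$ iff there is a finite $X\subseteq T$ such that $s_I\in P$ for every $P\subseteq X$ with $\{w\in X\mid \mathbb S[p\mapsto P].w\models\varphi^*\}\subseteq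 P$. -/

import Mathlib

universe u

namespace ModalMSO

/-! ## Labelled transition systems -/

/-- A (pointed) labelled transition system with universe `T`. The set of proposition letters is `ℕ`;
for a finite set `P` of letters, the `P`-labelled systems are those with `color s ⊆ P` for all `s`. -/
structure LTS (T : Type u) where
  rel : T → T → Prop
  color : T → Set ℕ
  root : T

namespace LTS

variable {T : Type u}

/-- The set of nodes where the letter `p` holds. -/
def val (S : LTS T) (p : ℕ) : Set T := {s | p ∈ S.color s}

/-- The set `R[s]` of successors of `s`. -/
def succ (S : LTS T) (s : T) : Set T := {t | S.rel s t}

/-- The `p`-variant `S[p ↦ X]`. -/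
def assign (S : LTS T) (p : ℕ) (X : Set T) : LTS T :=
  { S with color := fun s => {q | (q = p ∧ s ∈ X) ∨ (q ≠ p ∧ q ∈ S.color s)} }

/-- The same system with `t` as its distinguished node. -/
def atNode (S : LTS T) (t : T) : LTS T := { S with root := t }

/-- `π` is a finite path starting at `s`, as the (nonempty) list of its nodes. -/
def IsPathFrom (S : LTS T) (s : T) (π : List T) : Prop :=
  π.head? = some s ∧ π.IsChain S.rel

/-- A bundle: a nonempty set of finite paths with a common starting point, without an infinite
strictly ascending chain for the initial-segment relation. -/
def IsBundle (S : LTS T) (B : Set (List T)) : Prop :=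
  B.Nonempty ∧ (∃ s, ∀ π ∈ B, S.IsPathFrom s π) ∧
    ¬ ∃ f : ℕ → List T, ∀ k, f k ∈ B ∧ f k <+: f (k + 1) ∧ f k ≠ f (k + 1)

/-- `X` is noetherian: every element of `X` lies on some path of one fixed bundle. -/
def Noetherian (S : LTS T) (X : Set T) : Prop :=
  ∃ B, S.IsBundle B ∧ ∀ t ∈ X, ∃ π ∈ B, t ∈ π

/-- The variant in which the bundle is moreover closed under initial segments. In a tree, these are
exactly the subsets of well-founded subtrees. (Without the closure, a bundle may consist of the
paths `0,1,…,k,x_k` for all `k`, and cover an infinite path.) -/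
def WfNoetherian (S : LTS T) (X : Set T) : Prop :=
  ∃ B, S.IsBundle B ∧ (∀ π ∈ B, ∀ ρ, ρ ≠ [] → ρ <+: π → ρ ∈ B) ∧ ∀ t ∈ X, ∃ π ∈ B, t ∈ π

end LTS

/-! ## One-sorted monadic second-order logic -/

/-- Formulas `⇓p`, `p ⊑ q`, `R(p,q)`, `¬φ`, `φ ∨ ψ`, `∃p.φ`. -/
inductive MSO : Type
  | here (p : ℕ)
  | sub (p q : ℕ)
  | rel (p q : ℕ)
  | neg (φ : MSO)
  | or (φ ψ : MSO)
  | ex (p : ℕ) (φ : MSO)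

namespace MSO

/-- Free letters. -/
def free : MSO → Set ℕ
  | here p => {p}
  | sub p q => {p, q}
  | rel p q => {p, q}
  | neg φ => φ.free
  | or φ ψ => φ.free ∪ ψ.free
  | ex p φ => φ.free \ {p}

/-- Bound letters. -/
def bound : MSO → Set ℕ
  | here _ => ∅
  | sub _ _ => ∅
  | rel _ _ => ∅
  | neg φ => φ.bound
  | or φ ψ => φ.bound ∪ ψ.bound
  | ex p φ => insert p φ.bound

/-- Truth, where second-order quantifiers range over the sets `X` with `K S X`. Noetherian and weak
monadic second-order logic have as `K` the noetherian sets of `S` and the finite sets. -/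
def Sat {T : Type u} (K : LTS T → Set T → Prop) : MSO → LTS T → Prop
  | here p, S => S.val p = {S.root}
  | sub p q, S => S.val p ⊆ S.val q
  | rel p q, S => ∀ s ∈ S.val p, ∃ t ∈ S.val q, S.rel s t
  | neg φ, S => ¬ φ.Sat K S
  | or φ ψ, S => φ.Sat K S ∨ ψ.Sat K S
  | ex p φ, S => ∃ X : Set T, K S X ∧ φ.Sat K (S.assign p X)

/-- Gödel numbering. -/
def code : MSO → ℕ
  | here p => Nat.pair 0 p
  | sub p q => Nat.pair 1 (Nat.pair p q)
  | rel p q => Nat.pair 2 (Nat.pair p q)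
  | neg φ => Nat.pair 3 φ.code
  | or φ ψ => Nat.pair 4 (Nat.pair φ.code ψ.code)
  | ex p φ => Nat.pair 5 (Nat.pair p φ.code)

theorem code_injective : Function.Injective code := by
  intro φ
  induction φ with
  | here p => intro ψ h; cases ψ <;> simp_all [code, Nat.pair_eq_pair]
  | sub p q => intro ψ h; cases ψ <;> simp_all [code, Nat.pair_eq_pair]
  | rel p q => intro ψ h; cases ψ <;> simp_all [code, Nat.pair_eq_pair]
  | neg φ ih =>
    intro ψ h
    cases ψ <;> simp [code, Nat.pair_eq_pair] at h
    rw [ih h]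
  | or φ φ' ih ih' =>
    intro ψ h
    cases ψ <;> simp [code, Nat.pair_eq_pair] at h
    rw [ih h.1, ih' h.2]
  | ex p φ ih =>
    intro ψ h
    cases ψ <;> simp [code, Nat.pair_eq_pair] at h
    rw [h.1, ih h.2]

end MSO

/-! ## One-step first-order languages -/

/-- First-order formulas with equality and the infinity quantifiers, over the monadic predicates
`A` and the individual variables `ℕ`. -/
inductive OneStep (A : Type) : Type
  | pred (a : A) (x : ℕ)
  | npred (a : A) (x : ℕ)
  | eq (x y : ℕ)
  | neq (x y : ℕ)
  | or (α β : OneStep A)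
  | and (α β : OneStep A)
  | ex (x : ℕ) (α : OneStep A)
  | all (x : ℕ) (α : OneStep A)
  | exInf (x : ℕ) (α : OneStep A)
  | allInf (x : ℕ) (α : OneStep A)

/-- The two one-step languages: first-order logic with equality, and its extension with the
infinity quantifiers. -/
inductive OneStepLang : Type
  | foe
  | foeInf

namespace OneStep

variable {A : Type}

/-- Free individual variables. -/
def free : OneStep A → Set ℕ
  | pred _ x => {x}
  | npred _ x => {x}
  | eq x y => {x, y}
  | neq x y => {x, y}
  | or α β => α.free ∪ β.free
  | and α β => α.free ∪ β.free
  | ex x α => α.free \ {x}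
  | all x α => α.free \ {x}
  | exInf x α => α.free \ {x}
  | allInf x α => α.free \ {x}

/-- The monadic predicates occurring in a formula. -/
def preds : OneStep A → Set A
  | pred a _ => {a}
  | npred a _ => {a}
  | eq _ _ => ∅
  | neq _ _ => ∅
  | or α β => α.preds ∪ β.preds
  | and α β => α.preds ∪ β.preds
  | ex _ α => α.preds
  | all _ α => α.preds
  | exInf _ α => α.preds
  | allInf _ α => α.preds

/-- No negated predicate occurs. -/
def Positive : OneStep A → Prop
  | pred _ _ => True
  | npred _ _ => False
  | eq _ _ => True
  | neq _ _ => True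
  | or α β => α.Positive ∧ β.Positive
  | and α β => α.Positive ∧ β.Positive
  | ex _ α => α.Positive
  | all _ α => α.Positive
  | exInf _ α => α.Positive
  | allInf _ α => α.Positive

/-- No infinity quantifier occurs. -/
def FirstOrder : OneStep A → Prop
  | pred _ _ => True
  | npred _ _ => True
  | eq _ _ => True
  | neq _ _ => True
  | or α β => α.FirstOrder ∧ β.FirstOrder
  | and α β => α.FirstOrder ∧ β.FirstOrder
  | ex _ α => α.FirstOrder
  | all _ α => α.FirstOrder
  | exInf _ _ => False
  | allInf _ _ => False

/-- The boolean dual. -/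
def dual : OneStep A → OneStep A
  | pred a x => pred a x
  | npred a x => npred a x
  | eq x y => neq x y
  | neq x y => eq x y
  | or α β => and α.dual β.dual
  | and α β => or α.dual β.dual
  | ex x α => all x α.dual
  | all x α => ex x α.dual
  | exInf x α => allInf x α.dual
  | allInf x α => exInf x α.dual

/-- Truth in the one-step model with domain `D ⊆ T` and valuation `V`; the quantifiers range over
`D`. Assignments take values in the ambient `T`, so that `D` may be empty: then formulas `∃x.α`
and `∃^∞x.α` are false, and `∀x.α` and `∀^∞x.α` are true. The truth value of a sentence does not
depend on the assignment. -/
def Sat {T : Type u} (D : Set T) (V : A → Set T) : OneStep A → (ℕ → T) → Prop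
  | pred a x, g => g x ∈ V a
  | npred a x, g => g x ∉ V a
  | eq x y, g => g x = g y
  | neq x y, g => g x ≠ g y
  | or α β, g => α.Sat D V g ∨ β.Sat D V g
  | and α β, g => α.Sat D V g ∧ β.Sat D V g
  | ex x α, g => ∃ s ∈ D, α.Sat D V (Function.update g x s)
  | all x α, g => ∀ s ∈ D, α.Sat D V (Function.update g x s)
  | exInf x α, g => {s ∈ D | α.Sat D V (Function.update g x s)}.Infinite
  | allInf x α, g => {s ∈ D | ¬ α.Sat D V (Function.update g x s)}.Finite

theorem sat_congr {T : Type u} (D : Set T) (V : A → Set T) (α : OneStep A) :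
    ∀ g h : ℕ → T, (∀ x ∈ α.free, g x = h x) → (α.Sat D V g ↔ α.Sat D V h) := by
  have key : ∀ (F : Set ℕ) (x : ℕ) (s : T) (g h : ℕ → T), (∀ y ∈ F \ {x}, g y = h y) →
      ∀ y ∈ F, Function.update g x s y = Function.update h x s y := by
    intro F x s g h hgh y hy
    by_cases hyx : y = x
    · subst hyx; simp
    · simp [hyx, hgh y ⟨hy, hyx⟩]
  induction α with
  | pred a x => intro g h H; simp [Sat, H x (by simp [free])]
  | npred a x => intro g h H; simp [Sat, H x (by simp [free])]
  | eq x y => intro g h H; simp [Sat, H x (by simp [free]), H y (by simp [free])]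
  | neq x y => intro g h H; simp [Sat, H x (by simp [free]), H y (by simp [free])]
  | or α β iha ihb =>
    intro g h H
    simp only [Sat]
    rw [iha g h fun x hx => H x (Or.inl hx), ihb g h fun x hx => H x (Or.inr hx)]
  | and α β iha ihb =>
    intro g h H
    simp only [Sat]
    rw [iha g h fun x hx => H x (Or.inl hx), ihb g h fun x hx => H x (Or.inr hx)]
  | ex x α ih =>
    intro g h H
    simp only [Sat, fun s => ih _ _ (key _ x s g h H)]
  | all x α ih =>
    intro g h H
    simp only [Sat, fun s => ih _ _ (key _ x s g h H)]
  | exInf x α ih =>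
    intro g h H
    simp only [Sat, fun s => ih _ _ (key _ x s g h H)]
  | allInf x α ih =>
    intro g h H
    simp only [Sat, fun s => ih _ _ (key _ x s g h H)]

/-- `α` is a (possibly open) formula of the language `L`. -/
def InLang (L : OneStepLang) (α : OneStep A) : Prop := L = .foeInf ∨ α.FirstOrder

/-- The positive fragment `L⁺(A)`: the positive sentences of `L`. -/
def Pos (L : OneStepLang) : Set (OneStep A) := {α | α.InLang L ∧ α.Positive ∧ α.free = ∅}

/-- The grammar of the `B`-continuous fragment, on possibly open formulas. The clause `wq` is
`W x.(α,β)`, that is, `∀x.(α ∨ β) ∧ ∀^∞x.β`; it belongs to the language with infinity quantifiers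
only. -/
inductive ContGram (L : OneStepLang) (B : Set A) : OneStep A → Prop
  | pred {a : A} (x : ℕ) (ha : a ∈ B) : ContGram L B (pred a x)
  | base {β : OneStep A} (hL : β.InLang L) (hp : β.Positive) (hB : Disjoint β.preds B) :
      ContGram L B β
  | and {α β : OneStep A} (h₁ : ContGram L B α) (h₂ : ContGram L B β) : ContGram L B (and α β)
  | or {α β : OneStep A} (h₁ : ContGram L B α) (h₂ : ContGram L B β) : ContGram L B (or α β)
  | ex {α : OneStep A} (x : ℕ) (h : ContGram L B α) : ContGram L B (ex x α)
  | wq {α β : OneStep A} (x : ℕ) (hinf : L = .foeInf) (h : ContGram L B α) (hL : β.InLang L)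
      (hp : β.Positive) (hB : Disjoint β.preds B) :
      ContGram L B (and (all x (or α β)) (allInf x β))

/-- The `B`-continuous fragment: the sentences generated by the grammar. -/
def Cont (L : OneStepLang) (B : Set A) : Set (OneStep A) := {α | ContGram L B α ∧ α.free = ∅}

/-- The `B`-cocontinuous fragment. -/
def Cocont (L : OneStepLang) (B : Set A) : Set (OneStep A) := {α | α.dual ∈ Cont L B}

/-- Gödel numbering of the formulas with predicates `a₁, …, aₙ`. -/
def code {n : ℕ} : OneStep (Fin n) → ℕ
  | pred a x => Nat.pair 0 (Nat.pair a x)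
  | npred a x => Nat.pair 1 (Nat.pair a x)
  | eq x y => Nat.pair 2 (Nat.pair x y)
  | neq x y => Nat.pair 3 (Nat.pair x y)
  | or α β => Nat.pair 4 (Nat.pair α.code β.code)
  | and α β => Nat.pair 5 (Nat.pair α.code β.code)
  | ex x α => Nat.pair 6 (Nat.pair x α.code)
  | all x α => Nat.pair 7 (Nat.pair x α.code)
  | exInf x α => Nat.pair 8 (Nat.pair x α.code)
  | allInf x α => Nat.pair 9 (Nat.pair x α.code)

theorem code_injective {n : ℕ} : Function.Injective (code (n := n)) := by
  intro α
  induction α with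
  | pred a x =>
    intro β h
    cases β <;> simp [code, Nat.pair_eq_pair] at h
    rw [h.2, Fin.ext h.1]
  | npred a x =>
    intro β h
    cases β <;> simp [code, Nat.pair_eq_pair] at h
    rw [h.2, Fin.ext h.1]
  | eq x y => intro β h; cases β <;> simp_all [code, Nat.pair_eq_pair]
  | neq x y => intro β h; cases β <;> simp_all [code, Nat.pair_eq_pair]
  | or α α' ih ih' =>
    intro β h
    cases β <;> simp [code, Nat.pair_eq_pair] at h
    rw [ih h.1, ih' h.2]
  | and α α' ih ih' =>
    intro β h
    cases β <;> simp [code, Nat.pair_eq_pair] at h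
    rw [ih h.1, ih' h.2]
  | ex x α ih =>
    intro β h
    cases β <;> simp [code, Nat.pair_eq_pair] at h
    rw [h.1, ih h.2]
  | all x α ih =>
    intro β h
    cases β <;> simp [code, Nat.pair_eq_pair] at h
    rw [h.1, ih h.2]
  | exInf x α ih =>
    intro β h
    cases β <;> simp [code, Nat.pair_eq_pair] at h
    rw [h.1, ih h.2]
  | allInf x α ih =>
    intro β h
    cases β <;> simp [code, Nat.pair_eq_pair] at h
    rw [h.1, ih h.2]

end OneStep

/-! ## The `μ`-calculi over the one-step languages -/

/-- Raw formulas of the `μ`-calculus over the largest one-step language. In `nxt α φ`, the formula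
`φ i` is the argument that belongs to the `i`-th predicate of `α`. -/
inductive MuFormula : Type
  | letter (q : ℕ)
  | nletter (q : ℕ)
  | or (φ ψ : MuFormula)
  | and (φ ψ : MuFormula)
  | nxt {n : ℕ} (α : OneStep (Fin n)) (φ : Fin n → MuFormula)
  | mu (p : ℕ) (φ : MuFormula)
  | nu (p : ℕ) (φ : MuFormula)

namespace MuFormula

/-- Free letters. -/
def free : MuFormula → Set ℕ
  | letter q => {q}
  | nletter q => {q}
  | or φ ψ => φ.free ∪ ψ.free
  | and φ ψ => φ.free ∪ ψ.free
  | nxt _ φ => ⋃ i, (φ i).free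
  | mu p φ => φ.free \ {p}
  | nu p φ => φ.free \ {p}

/-- No free occurrence of `p` in the formula is negated. -/
def PositiveIn (p : ℕ) : MuFormula → Prop
  | letter _ => True
  | nletter q => q ≠ p
  | or φ ψ => φ.PositiveIn p ∧ ψ.PositiveIn p
  | and φ ψ => φ.PositiveIn p ∧ ψ.PositiveIn p
  | nxt _ φ => ∀ i, (φ i).PositiveIn p
  | mu q φ => q = p ∨ φ.PositiveIn p
  | nu q φ => q = p ∨ φ.PositiveIn p

/-- The meaning of a formula: the set of nodes where it is true. -/
def ext {T : Type u} : MuFormula → LTS T → Set T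
  | letter q, S => S.val q
  | nletter q, S => (S.val q)ᶜ
  | or φ ψ, S => φ.ext S ∪ ψ.ext S
  | and φ ψ, S => φ.ext S ∩ ψ.ext S
  | nxt α φ, S =>
      {s | α.Sat (S.succ s) (fun i => {t | t ∈ S.succ s ∧ t ∈ (φ i).ext S}) (fun _ => s)}
  | mu p φ, S => ⋂₀ {X | φ.ext (S.assign p X) ⊆ X}
  | nu p φ, S => ⋃₀ {X | X ⊆ φ.ext (S.assign p X)}

/-- Truth of a formula in a pointed system. -/
def Sat {T : Type u} (φ : MuFormula) (S : LTS T) : Prop := S.root ∈ φ.ext S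

/-- The language `μL`. -/
inductive Mu (L : OneStepLang) : MuFormula → Prop
  | letter (q : ℕ) : Mu L (letter q)
  | nletter (q : ℕ) : Mu L (nletter q)
  | or {φ ψ : MuFormula} (h₁ : Mu L φ) (h₂ : Mu L ψ) : Mu L (or φ ψ)
  | and {φ ψ : MuFormula} (h₁ : Mu L φ) (h₂ : Mu L ψ) : Mu L (and φ ψ)
  | nxt {n : ℕ} {α : OneStep (Fin n)} {φ : Fin n → MuFormula} (hα : α ∈ OneStep.Pos L)
      (h : ∀ i, Mu L (φ i)) : Mu L (nxt α φ)
  | mu {p : ℕ} {φ : MuFormula} (h : Mu L φ) (hp : φ.PositiveIn p) : Mu L (mu p φ)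
  | nu {p : ℕ} {φ : MuFormula} (h : Mu L φ) (hp : φ.PositiveIn p) : Mu L (nu p φ)

/-- `φ` is a formula of `μL` in which no letter of `Q` is free. -/
def FreeOf (L : OneStepLang) (Q : Set ℕ) (φ : MuFormula) : Prop := Mu L φ ∧ Disjoint φ.free Q

/-- The formulas of `μL` that are (syntactically) noetherian in `Q`. -/
inductive Noe (L : OneStepLang) : Set ℕ → MuFormula → Prop
  | letter {Q : Set ℕ} {q : ℕ} (hq : q ∈ Q) : Noe L Q (letter q)
  | base {Q : Set ℕ} {ψ : MuFormula} (h : FreeOf L Q ψ) : Noe L Q ψ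
  | or {Q : Set ℕ} {φ ψ : MuFormula} (h₁ : Noe L Q φ) (h₂ : Noe L Q ψ) : Noe L Q (or φ ψ)
  | and {Q : Set ℕ} {φ ψ : MuFormula} (h₁ : Noe L Q φ) (h₂ : Noe L Q ψ) : Noe L Q (and φ ψ)
  | nxt {Q : Set ℕ} {n : ℕ} {α : OneStep (Fin n)} {φ : Fin n → MuFormula}
      (hα : α ∈ OneStep.Pos L) (h : ∀ i, Noe L Q (φ i)) : Noe L Q (nxt α φ)
  | mu {Q : Set ℕ} {p : ℕ} {φ : MuFormula} (h : Noe L (Q ∪ {p}) φ) : Noe L Q (mu p φ)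

/-- The formulas of `μL` that are (syntactically) co-noetherian in `Q`. -/
inductive Conoe (L : OneStepLang) : Set ℕ → MuFormula → Prop
  | letter {Q : Set ℕ} {q : ℕ} (hq : q ∈ Q) : Conoe L Q (letter q)
  | base {Q : Set ℕ} {ψ : MuFormula} (h : FreeOf L Q ψ) : Conoe L Q ψ
  | or {Q : Set ℕ} {φ ψ : MuFormula} (h₁ : Conoe L Q φ) (h₂ : Conoe L Q ψ) : Conoe L Q (or φ ψ)
  | and {Q : Set ℕ} {φ ψ : MuFormula} (h₁ : Conoe L Q φ) (h₂ : Conoe L Q ψ) :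
      Conoe L Q (and φ ψ)
  | nxt {Q : Set ℕ} {n : ℕ} {α : OneStep (Fin n)} {φ : Fin n → MuFormula}
      (hα : α ∈ OneStep.Pos L) (h : ∀ i, Conoe L Q (φ i)) : Conoe L Q (nxt α φ)
  | nu {Q : Set ℕ} {p : ℕ} {φ : MuFormula} (h : Conoe L (Q ∪ {p}) φ) : Conoe L Q (nu p φ)

/-- The formulas of `μL` that are (syntactically) continuous in `Q`. In the modal clause, `B` is the
set of the predicates of `α` whose arguments are again continuous in `Q`; the other arguments
are `Q`-free. -/
inductive Cont (L : OneStepLang) : Set ℕ → MuFormula → Prop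
  | letter {Q : Set ℕ} {q : ℕ} (hq : q ∈ Q) : Cont L Q (letter q)
  | base {Q : Set ℕ} {ψ : MuFormula} (h : FreeOf L Q ψ) : Cont L Q ψ
  | or {Q : Set ℕ} {φ ψ : MuFormula} (h₁ : Cont L Q φ) (h₂ : Cont L Q ψ) : Cont L Q (or φ ψ)
  | and {Q : Set ℕ} {φ ψ : MuFormula} (h₁ : Cont L Q φ) (h₂ : Cont L Q ψ) : Cont L Q (and φ ψ)
  | nxt {Q : Set ℕ} {n : ℕ} {α : OneStep (Fin n)} {φ : Fin n → MuFormula} (B : Set (Fin n))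
      (hα : α ∈ OneStep.Cont L B) (h : ∀ i ∈ B, Cont L Q (φ i))
      (h' : ∀ i ∉ B, FreeOf L Q (φ i)) : Cont L Q (nxt α φ)
  | mu {Q : Set ℕ} {p : ℕ} {φ : MuFormula} (h : Cont L (Q ∪ {p}) φ) : Cont L Q (mu p φ)

/-- The formulas of `μL` that are (syntactically) co-continuous in `Q`. -/
inductive Cocont (L : OneStepLang) : Set ℕ → MuFormula → Prop
  | letter {Q : Set ℕ} {q : ℕ} (hq : q ∈ Q) : Cocont L Q (letter q)
  | base {Q : Set ℕ} {ψ : MuFormula} (h : FreeOf L Q ψ) : Cocont L Q ψ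
  | or {Q : Set ℕ} {φ ψ : MuFormula} (h₁ : Cocont L Q φ) (h₂ : Cocont L Q ψ) :
      Cocont L Q (or φ ψ)
  | and {Q : Set ℕ} {φ ψ : MuFormula} (h₁ : Cocont L Q φ) (h₂ : Cocont L Q ψ) :
      Cocont L Q (and φ ψ)
  | nxt {Q : Set ℕ} {n : ℕ} {α : OneStep (Fin n)} {φ : Fin n → MuFormula} (B : Set (Fin n))
      (hα : α ∈ OneStep.Cocont L B) (h : ∀ i ∈ B, Cocont L Q (φ i))
      (h' : ∀ i ∉ B, FreeOf L Q (φ i)) : Cocont L Q (nxt α φ)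
  | nu {Q : Set ℕ} {p : ℕ} {φ : MuFormula} (h : Cocont L (Q ∪ {p}) φ) : Cocont L Q (nu p φ)

/-- The alternation-free `μ`-calculus `μ_D L`. -/
inductive MuD (L : OneStepLang) : MuFormula → Prop
  | letter (q : ℕ) : MuD L (letter q)
  | nletter (q : ℕ) : MuD L (nletter q)
  | or {φ ψ : MuFormula} (h₁ : MuD L φ) (h₂ : MuD L ψ) : MuD L (or φ ψ)
  | and {φ ψ : MuFormula} (h₁ : MuD L φ) (h₂ : MuD L ψ) : MuD L (and φ ψ)
  | nxt {n : ℕ} {α : OneStep (Fin n)} {φ : Fin n → MuFormula} (hα : α ∈ OneStep.Pos L)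
      (h : ∀ i, MuD L (φ i)) : MuD L (nxt α φ)
  | mu {p : ℕ} {φ : MuFormula} (h : MuD L φ) (hp : Noe L {p} φ) : MuD L (mu p φ)
  | nu {p : ℕ} {φ : MuFormula} (h : MuD L φ) (hp : Conoe L {p} φ) : MuD L (nu p φ)

/-- The continuous `μ`-calculus `μ_C L`. -/
inductive MuC (L : OneStepLang) : MuFormula → Prop
  | letter (q : ℕ) : MuC L (letter q)
  | nletter (q : ℕ) : MuC L (nletter q)
  | or {φ ψ : MuFormula} (h₁ : MuC L φ) (h₂ : MuC L ψ) : MuC L (or φ ψ)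
  | and {φ ψ : MuFormula} (h₁ : MuC L φ) (h₂ : MuC L ψ) : MuC L (and φ ψ)
  | nxt {n : ℕ} {α : OneStep (Fin n)} {φ : Fin n → MuFormula} (hα : α ∈ OneStep.Pos L)
      (h : ∀ i, MuC L (φ i)) : MuC L (nxt α φ)
  | mu {p : ℕ} {φ : MuFormula} (h : MuC L φ) (hp : Cont L {p} φ) : MuC L (mu p φ)
  | nu {p : ℕ} {φ : MuFormula} (h : MuC L φ) (hp : Cocont L {p} φ) : MuC L (nu p φ)

/-- Gödel numbering. -/
def code : MuFormula → ℕ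
  | letter q => Nat.pair 0 q
  | nletter q => Nat.pair 1 q
  | or φ ψ => Nat.pair 2 (Nat.pair φ.code ψ.code)
  | and φ ψ => Nat.pair 3 (Nat.pair φ.code ψ.code)
  | @nxt n α φ =>
      Nat.pair 4 (Nat.pair n (Nat.pair α.code
        (Encodable.encode (List.ofFn fun i => (φ i).code))))
  | mu p φ => Nat.pair 5 (Nat.pair p φ.code)
  | nu p φ => Nat.pair 6 (Nat.pair p φ.code)

theorem code_injective : Function.Injective code := by
  intro φ
  induction φ with
  | letter q => intro ψ h; cases ψ <;> simp_all [code, Nat.pair_eq_pair]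
  | nletter q => intro ψ h; cases ψ <;> simp_all [code, Nat.pair_eq_pair]
  | or φ φ' ih ih' =>
    intro ψ h
    cases ψ <;> simp only [code, Nat.pair_eq_pair] at h <;> try omega
    rw [ih h.2.1, ih' h.2.2]
  | and φ φ' ih ih' =>
    intro ψ h
    cases ψ <;> simp only [code, Nat.pair_eq_pair] at h <;> try omega
    rw [ih h.2.1, ih' h.2.2]
  | @nxt n α φ ih =>
    intro ψ h
    cases ψ <;> simp only [code, Nat.pair_eq_pair] at h <;> try omega
    obtain ⟨-, hn, hα, hl⟩ := h
    subst hn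
    have hf := List.ofFn_injective (Encodable.encode_injective hl)
    rw [OneStep.code_injective hα]
    congr 1
    funext i
    exact ih i (congrFun hf i)
  | mu p φ ih =>
    intro ψ h
    cases ψ <;> simp only [code, Nat.pair_eq_pair] at h <;> try omega
    rw [h.2.1, ih h.2.2]
  | nu p φ ih =>
    intro ψ h
    cases ψ <;> simp only [code, Nat.pair_eq_pair] at h <;> try omega
    rw [h.2.1, ih h.2.2]

end MuFormula

/-- The translation `t` is effective on the class `D`: some total computable function maps the
Gödel number of each `φ` in `D` to the Gödel number of `t φ`. -/
def EffectiveOn (D : MuFormula → Prop) (t : MuFormula → MSO) : Prop :=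
  ∃ f : ℕ → ℕ, Computable f ∧ ∀ φ, D φ → f φ.code = (t φ).code

/-- The formula `t φ` obeys the convention that no letter is both free and bound in it, and it has
no other free letters than `φ`. -/
def ProperTarget (t : MuFormula → MSO) (φ : MuFormula) : Prop :=
  Disjoint (t φ).free (t φ).bound ∧ (t φ).free ⊆ φ.free

/-- The formulas in `D` are truth-preservingly translated by `t` into the monadic second-order logic
whose quantifiers range over the sets in `K`, over all systems, and the least fixpoint is translated
through restricted prefixpoints: `t (μp.φ)` says that there is a set `X` in `K` such that the
distinguished node belongs to every prefixpoint `P ⊆ X` of the map `Y ↦ ⟦t φ⟧^{S[p ↦ Y]} ∩ X`. -/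
def IsTranslation (D : MuFormula → Prop) (K : ∀ T : Type u, LTS T → Set T → Prop)
    (t : MuFormula → MSO) : Prop :=
  (∀ φ, D φ → ProperTarget t φ ∧
    ∀ (T : Type u) (S : LTS T), φ.Sat S ↔ (t φ).Sat (K T) S) ∧
  (∀ p φ, D (.mu p φ) → ∀ (T : Type u) (S : LTS T),
    (t (.mu p φ)).Sat (K T) S ↔
      ∃ X : Set T, K T S X ∧ ∀ P : Set T, P ⊆ X →
        {w | (t φ).Sat (K T) ((S.assign p P).atNode w)} ∩ X ⊆ P → S.root ∈ P)

end ModalMSO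

open ModalMSO

/-!
Both translations are the same map `MuFormula.translate`, a standard translation into monadic second
order logic: first-order variables become set variables for singletons, a letter `nodeLetter` holds
the current node, and `μp.φ` becomes "there is a set `X` such that the current node lies in every
prefixpoint `P ⊆ X` of the restricted map `P ↦ φ(P) ∩ X`". For `νp.φ` the negation of the dual
statement is used; there the quantified set is the complement of the value of `p`, because the
quantifiers do not range over complements of small sets. Letters above the code of the formula are
fresh, and they serve as bound letters.

That `translate` preserves truth (`MuFormula.sat_toMSO`) reduces to a semantic fact: a least
fixpoint is the union of the least fixpoints of its restrictions to small sets `X`. This follows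
from *localization* (`MuFormula.Localizes`): if `φ` is noetherian (continuous) in `Q` and true at
`s`, then it stays true when the letters of `Q` are restricted to a set `X` that lies on a
well-founded tree of paths from `s` (that is finite). The proof by induction on `φ` uses only that
such sets, based at nodes, contain the singletons and are closed under unions and under attaching to
each node of `X` a set based there (`BasedFamily`). The closure under attaching handles the fixpoint
operators (`MuFormula.Localizes.mu`) and, once more, yields the restricted prefixpoints
(`MuFormula.Localizes.exists_restricted`). The modal clause is the only one that differs: in the
noetherian case the trees at the successors of `s` are joined under `s`, and in the continuous case
a continuous one-step formula depends on finitely many elements only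
(`OneStep.ContGram.exists_finite`). Well-founded trees are given by an inductive predicate
(`Grounded`), which produces bundles closed under initial segments, hence noetherian sets in both
senses; conversely, every restricted prefixpoint condition implies membership in the least fixpoint
by monotonicity, whatever `X` is. Greatest fixpoints are reduced to least ones by the dual formula,
evaluated in the complemented system (`MuFormula.Mu.ext_dual`).

On codes, the translation is a recursion along the code with a context that records the operators in
scope, and such recursions are primitive recursive (`exists_primrec_fix`).
-/

namespace ModalMSO

variable {T : Type u}

/-! ### Operations on transition systems -/

namespace LTS

@[simp] theorem val_assign_self (S : LTS T) (p : ℕ) (X : Set T) : (S.assign p X).val p = X := by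
  ext t; simp [val, assign]

theorem val_assign_of_ne (S : LTS T) {p q : ℕ} (h : q ≠ p) (X : Set T) :
    (S.assign p X).val q = S.val q := by
  ext t; simp [val, assign, h]

/-- The system in which the letters of `Q` hold at most inside `X`. -/
def restrict (S : LTS T) (Q : Set ℕ) (X : Set T) : LTS T :=
  { S with color := fun t => {q | q ∈ S.color t ∧ (q ∈ Q → t ∈ X)} }

theorem mem_val_restrict {S : LTS T} {Q : Set ℕ} {X : Set T} {q : ℕ} {t : T} :
    t ∈ (S.restrict Q X).val q ↔ t ∈ S.val q ∧ (q ∈ Q → t ∈ X) := Iff.rfl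

/-- The system in which every letter is replaced by its complement. -/
def compl (S : LTS T) : LTS T := { S with color := fun t => (S.color t)ᶜ }

theorem compl_assign (S : LTS T) (p : ℕ) (X : Set T) :
    (S.assign p X).compl = S.compl.assign p Xᶜ := by
  simp only [compl, assign, LTS.mk.injEq, true_and, and_true]
  funext t
  ext q
  by_cases h : q = p <;> simp [h]

end LTS

/-! ### One-step formulas: monotonicity, duality, continuity -/

namespace OneStep

variable {A : Type} {D : Set T} {L : OneStepLang} {B : Set A}

theorem Sat.mono {V W : A → Set T} {α : OneStep A} (hα : α.Positive)
    (h : ∀ a ∈ α.preds, V a ⊆ W a) : ∀ {g : ℕ → T}, α.Sat D V g → α.Sat D W g := by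
  induction α with
  | pred a x => exact fun hg => h a rfl hg
  | npred a x => exact hα.elim
  | eq x y => exact id
  | neq x y => exact id
  | or α β iha ihb =>
    exact Or.imp (iha hα.1 fun a ha => h a (.inl ha)) (ihb hα.2 fun a ha => h a (.inr ha))
  | and α β iha ihb =>
    exact And.imp (iha hα.1 fun a ha => h a (.inl ha)) (ihb hα.2 fun a ha => h a (.inr ha))
  | ex x α ih => exact fun ⟨s, hs, hg⟩ => ⟨s, hs, ih hα h hg⟩
  | all x α ih => exact fun hg s hs => ih hα h (hg s hs)
  | exInf x α ih => exact fun hg => Set.Infinite.mono (fun s hs => ⟨hs.1, ih hα h hs.2⟩) hg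
  | allInf x α ih => exact fun hg => hg.subset fun s hs => ⟨hs.1, fun h' => hs.2 (ih hα h h')⟩

@[simp] theorem dual_dual (α : OneStep A) : α.dual.dual = α := by
  induction α <;> simp_all [dual]

@[simp] theorem free_dual (α : OneStep A) : α.dual.free = α.free := by
  induction α <;> simp_all [dual, free]

@[simp] theorem positive_dual (α : OneStep A) : α.dual.Positive ↔ α.Positive := by
  induction α <;> simp_all [dual, Positive]

@[simp] theorem firstOrder_dual (α : OneStep A) : α.dual.FirstOrder ↔ α.FirstOrder := by
  induction α <;> simp_all [dual, FirstOrder]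

theorem dual_mem_pos {α : OneStep A} (h : α ∈ Pos L) : α.dual ∈ Pos L := by
  simpa [Pos, InLang] using h

theorem free_binder {F : Set ℕ} {x : ℕ} {s : T} {g : ℕ → T} (hs : s ∈ D)
    (h : ∀ y ∈ F \ {x}, g y ∈ D) : ∀ y ∈ F, Function.update g x s y ∈ D := by
  intro y hy
  by_cases hyx : y = x
  · subst hyx; simpa
  · simpa [hyx] using h y ⟨hy, hyx⟩

/-- Assignments with values in the domain are needed because the valuations are complemented inside
the domain only. -/
theorem sat_dual {V W : A → Set T} (hVW : ∀ a, ∀ t ∈ D, t ∈ W a ↔ t ∉ V a) (α : OneStep A) :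
    ∀ g : ℕ → T, (∀ x ∈ α.free, g x ∈ D) → (α.dual.Sat D W g ↔ ¬ α.Sat D V g) := by
  induction α with
  | pred a x => exact fun g hg => hVW a _ (hg x rfl)
  | npred a x => exact fun g hg => not_congr (hVW a _ (hg x rfl))
  | eq x y => exact fun g _ => Iff.rfl
  | neq x y => exact fun g _ => not_not.symm
  | or α β iha ihb =>
    intro g hg
    simp only [dual, Sat, not_or, iha g fun x hx => hg x (.inl hx),
      ihb g fun x hx => hg x (.inr hx)]
  | and α β iha ihb =>
    intro g hg
    simp only [dual, Sat, not_and_or, iha g fun x hx => hg x (.inl hx),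
      ihb g fun x hx => hg x (.inr hx)]
  | ex x α ih =>
    intro g hg
    have := fun s hs => ih _ (free_binder (s := s) hs hg)
    simp only [dual, Sat, not_exists, not_and]
    exact forall₂_congr this
  | all x α ih =>
    intro g hg
    have := fun s hs => ih _ (free_binder (s := s) hs hg)
    simp only [dual, Sat, not_forall]
    exact exists_congr fun s => by
      constructor
      · exact fun h => ⟨h.1, (this s h.1).1 h.2⟩
      · exact fun ⟨h, h'⟩ => ⟨h, (this s h).2 h'⟩
  | exInf x α ih =>
    intro g hg
    have := fun s hs => ih _ (free_binder (s := s) hs hg)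
    simp only [dual, Sat, Set.not_infinite]
    refine iff_of_eq (congrArg _ (Set.ext fun s => and_congr_right fun hs => ?_))
    rw [this s hs, not_not]
  | allInf x α ih =>
    intro g hg
    have := fun s hs => ih _ (free_binder (s := s) hs hg)
    simp only [dual, Sat]
    refine iff_of_eq (congrArg _ (Set.ext fun s => and_congr_right fun hs => ?_))
    rw [this s hs]

theorem ContGram.inLang_positive {α : OneStep A} (h : ContGram L B α) :
    α.InLang L ∧ α.Positive := by
  induction h with
  | pred x ha => simp [InLang, FirstOrder, Positive]
  | base hL hp hB => exact ⟨hL, hp⟩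
  | and _ _ ih₁ ih₂ =>
    exact ⟨ih₁.1.elim .inl fun h₁ => ih₂.1.imp_right fun h₂ => ⟨h₁, h₂⟩, ih₁.2, ih₂.2⟩
  | or _ _ ih₁ ih₂ =>
    exact ⟨ih₁.1.elim .inl fun h₁ => ih₂.1.imp_right fun h₂ => ⟨h₁, h₂⟩, ih₁.2, ih₂.2⟩
  | ex x _ ih => exact ih
  | wq x hinf _ _ hp _ ih => exact ⟨.inl hinf, ⟨ih.2, hp⟩, hp⟩

theorem Cont.mem_pos {α : OneStep A} (h : α ∈ Cont L B) : α ∈ Pos L :=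
  ⟨h.1.inLang_positive.1, h.1.inLang_positive.2, h.2⟩

/-- A continuous formula depends on finitely many elements of its predicates in `B` only. In the
clause `W x.(α,β)` only the finitely many elements that fail `β` need witnesses for `α`. -/
theorem ContGram.exists_finite {α : OneStep A} (h : ContGram L B α) (V : A → Set T) :
    ∀ g : ℕ → T, α.Sat D V g →
      ∃ U : Set T, U.Finite ∧ α.Sat D (fun a => {t | t ∈ V a ∧ (a ∈ B → t ∈ U)}) g := by
  have mono : ∀ {U U' : Set T}, U ⊆ U' → ∀ {α : OneStep A}, ContGram L B α → ∀ {g : ℕ → T},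
      α.Sat D (fun a => {t | t ∈ V a ∧ (a ∈ B → t ∈ U)}) g →
      α.Sat D (fun a => {t | t ∈ V a ∧ (a ∈ B → t ∈ U')}) g := by
    intro U U' hU α hα g
    refine Sat.mono hα.inLang_positive.2 ?_
    exact fun a _ t ht => ⟨ht.1, fun ha => hU (ht.2 ha)⟩
  have base : ∀ {β : OneStep A}, β.Positive → Disjoint β.preds B → ∀ {g : ℕ → T},
      β.Sat D V g → ∀ U : Set T, β.Sat D (fun a => {t | t ∈ V a ∧ (a ∈ B → t ∈ U)}) g :=
    fun hp hB _ hg U => Sat.mono hp (W := fun a => {t | t ∈ V a ∧ (a ∈ B → t ∈ U)})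
      (fun a ha t ht => ⟨ht, fun hb => (Set.disjoint_left.1 hB ha hb).elim⟩) hg
  induction h with
  | pred x ha => exact fun g hg => ⟨{g x}, Set.finite_singleton _, hg, fun _ => rfl⟩
  | base hL hp hB => exact fun g hg => ⟨∅, Set.finite_empty, base hp hB hg ∅⟩
  | and h₁ h₂ ih₁ ih₂ =>
    rintro g ⟨hg₁, hg₂⟩
    obtain ⟨U₁, hU₁, h₁'⟩ := ih₁ g hg₁
    obtain ⟨U₂, hU₂, h₂'⟩ := ih₂ g hg₂
    exact ⟨U₁ ∪ U₂, hU₁.union hU₂, mono Set.subset_union_left h₁ h₁',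
      mono Set.subset_union_right h₂ h₂'⟩
  | or h₁ h₂ ih₁ ih₂ =>
    rintro g (hg | hg)
    · obtain ⟨U, hU, h'⟩ := ih₁ g hg
      exact ⟨U, hU, .inl h'⟩
    · obtain ⟨U, hU, h'⟩ := ih₂ g hg
      exact ⟨U, hU, .inr h'⟩
  | ex x h ih =>
    rintro g ⟨s, hs, hg⟩
    obtain ⟨U, hU, h'⟩ := ih _ hg
    exact ⟨U, hU, s, hs, h'⟩
  | @wq α β x hinf h hL hp hB ih =>
    rintro g ⟨hall, hfin⟩
    have key : ∀ s, ∃ U : Set T, U.Finite ∧ (α.Sat D V (Function.update g x s) →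
        α.Sat D (fun a => {t | t ∈ V a ∧ (a ∈ B → t ∈ U)}) (Function.update g x s)) := by
      intro s
      by_cases hs : α.Sat D V (Function.update g x s)
      · obtain ⟨U, hU, h'⟩ := ih _ hs
        exact ⟨U, hU, fun _ => h'⟩
      · exact ⟨∅, Set.finite_empty, fun h' => (hs h').elim⟩
    choose U hU hUα using key
    refine ⟨⋃ s ∈ {s ∈ D | ¬ β.Sat D V (Function.update g x s)}, U s,
      Set.Finite.biUnion hfin fun s _ => hU s, fun s hs => ?_,
      Set.Finite.subset hfin fun s hs => ⟨hs.1, fun h' => hs.2 (base hp hB h' _)⟩⟩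
    by_cases hβ : β.Sat D V (Function.update g x s)
    · exact .inr (base hp hB hβ _)
    · refine .inl (mono ?_ h (hUα s ((hall s hs).resolve_right hβ)))
      exact Set.subset_biUnion_of_mem (u := U) (show s ∈ {s ∈ D | _} from ⟨hs, hβ⟩)

end OneStep

/-! ### Fixpoint formulas: monotonicity and duality -/

namespace MuFormula

variable {L : OneStepLang} {Q : Set ℕ} {φ ψ : MuFormula} {p q : ℕ}

theorem positiveIn_of_notMem_free : ∀ {φ : MuFormula}, q ∉ φ.free → φ.PositiveIn q := by
  intro φ
  induction φ with
  | letter r => exact fun _ => trivial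
  | nletter r => exact fun h h' => h h'.symm
  | or φ ψ ih₁ ih₂ => exact fun h => ⟨ih₁ fun h' => h (.inl h'), ih₂ fun h' => h (.inr h')⟩
  | and φ ψ ih₁ ih₂ => exact fun h => ⟨ih₁ fun h' => h (.inl h'), ih₂ fun h' => h (.inr h')⟩
  | nxt α φ ih => exact fun h i => ih i fun h' => h (Set.mem_iUnion.2 ⟨i, h'⟩)
  | mu p φ ih =>
    exact fun h => or_iff_not_imp_left.2 fun hp => ih fun h' => h ⟨h', fun e => hp e.symm⟩
  | nu p φ ih =>
    exact fun h => or_iff_not_imp_left.2 fun hp => ih fun h' => h ⟨h', fun e => hp e.symm⟩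

/-- A formula is monotone in the letters that occur only positively, and it depends only on its free
letters. -/
theorem Mu.ext_mono (hφ : Mu L φ) : ∀ {S S' : LTS T}, S.rel = S'.rel →
    (∀ q ∈ φ.free, S.val q ⊆ S'.val q ∧ (¬ φ.PositiveIn q → S'.val q ⊆ S.val q)) →
    φ.ext S ⊆ φ.ext S' := by
  have binder : ∀ {p : ℕ} {φ : MuFormula} {S S' : LTS T} (X : Set T),
      (∀ q ∈ φ.free \ {p}, S.val q ⊆ S'.val q ∧
        (¬ (p = q ∨ φ.PositiveIn q) → S'.val q ⊆ S.val q)) →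
      ∀ q ∈ φ.free, (S.assign p X).val q ⊆ (S'.assign p X).val q ∧
        (¬ φ.PositiveIn q → (S'.assign p X).val q ⊆ (S.assign p X).val q) := by
    intro p φ S S' X h q hq
    by_cases hqp : q = p
    · subst hqp; simp
    · rw [LTS.val_assign_of_ne _ hqp, LTS.val_assign_of_ne _ hqp]
      exact (h q ⟨hq, hqp⟩).imp_right fun h' hn => h' (not_or.2 ⟨fun e => hqp e.symm, hn⟩)
  induction hφ with
  | letter q => exact fun _ h => (h q rfl).1
  | nletter q => exact fun _ h => Set.compl_subset_compl.2 ((h q rfl).2 fun h' => h' rfl)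
  | or _ _ ih₁ ih₂ =>
    exact fun hr h => Set.union_subset_union
      (ih₁ hr fun q hq => (h q (.inl hq)).imp_right fun h' hn => h' fun hn' => hn hn'.1)
      (ih₂ hr fun q hq => (h q (.inr hq)).imp_right fun h' hn => h' fun hn' => hn hn'.2)
  | and _ _ ih₁ ih₂ =>
    exact fun hr h => Set.inter_subset_inter
      (ih₁ hr fun q hq => (h q (.inl hq)).imp_right fun h' hn => h' fun hn' => hn hn'.1)
      (ih₂ hr fun q hq => (h q (.inr hq)).imp_right fun h' hn => h' fun hn' => hn hn'.2)
  | nxt hα _ ih =>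
    intro S S' hr h s hs
    have hsucc : S'.succ s = S.succ s := by simp only [LTS.succ, hr]
    simp only [ext, Set.mem_ofPred_eq, hsucc] at hs ⊢
    refine hs.mono hα.2.1 ?_
    exact fun i _ t ht => ⟨ht.1, ih i hr (fun q hq =>
      (h q (Set.mem_iUnion.2 ⟨i, hq⟩)).imp_right fun h' hn => h' fun hn' => hn (hn' i)) ht.2⟩
  | mu _ _ ih =>
    exact fun {S S'} hr h => Set.sInter_subset_sInter fun X hX =>
      (ih (S := S.assign _ X) (S' := S'.assign _ X) hr (binder X h)).trans hX
  | nu _ _ ih =>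
    exact fun {S S'} hr h => Set.sUnion_subset_sUnion fun X hX =>
      hX.trans (ih (S := S.assign _ X) (S' := S'.assign _ X) hr (binder X h))

/-- Monotonicity in a set of letters that occur only positively. -/
theorem Mu.ext_mono_of_positive (hφ : Mu L φ) (hpos : ∀ q ∈ Q, φ.PositiveIn q) {S S' : LTS T}
    (hr : S.rel = S'.rel) (h : ∀ q ∈ Q, S.val q ⊆ S'.val q)
    (h' : ∀ q ∉ Q, S.val q = S'.val q) : φ.ext S ⊆ φ.ext S' := by
  refine hφ.ext_mono hr fun q _ => ?_
  by_cases hq : q ∈ Q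
  · exact ⟨h q hq, fun hn => (hn (hpos q hq)).elim⟩
  · exact ⟨(h' q hq).subset, fun _ => (h' q hq).symm.subset⟩

theorem Mu.ext_congr (hφ : Mu L φ) {S S' : LTS T} (hr : S.rel = S'.rel)
    (h : ∀ q ∈ φ.free, S.val q = S'.val q) : φ.ext S = φ.ext S' :=
  (hφ.ext_mono hr fun q hq => ⟨(h q hq).subset, fun _ => (h q hq).symm.subset⟩).antisymm
    (hφ.ext_mono hr.symm fun q hq => ⟨(h q hq).symm.subset, fun _ => (h q hq).subset⟩)

/-- The dual formula: it is true in the complemented system where the formula itself is false. -/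
def dual : MuFormula → MuFormula
  | letter q => letter q
  | nletter q => nletter q
  | or φ ψ => and φ.dual ψ.dual
  | and φ ψ => or φ.dual ψ.dual
  | nxt α φ => nxt α.dual fun i => (φ i).dual
  | mu p φ => nu p φ.dual
  | nu p φ => mu p φ.dual

@[simp] theorem dual_dual (φ : MuFormula) : φ.dual.dual = φ := by
  induction φ <;> simp_all [dual]

@[simp] theorem free_dual (φ : MuFormula) : φ.dual.free = φ.free := by
  induction φ <;> simp_all [dual, free]

@[simp] theorem positiveIn_dual (φ : MuFormula) : φ.dual.PositiveIn q ↔ φ.PositiveIn q := by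
  induction φ <;> simp_all [dual, PositiveIn]

theorem Mu.dual (h : Mu L φ) : Mu L φ.dual := by
  induction h with
  | letter q => exact .letter q
  | nletter q => exact .nletter q
  | or _ _ ih₁ ih₂ => exact .and ih₁ ih₂
  | and _ _ ih₁ ih₂ => exact .or ih₁ ih₂
  | nxt hα _ ih => exact .nxt (OneStep.dual_mem_pos hα) ih
  | mu _ hp ih => exact .nu ih ((positiveIn_dual _).2 hp)
  | nu _ hp ih => exact .mu ih ((positiveIn_dual _).2 hp)

theorem FreeOf.dual (h : FreeOf L Q φ) : FreeOf L Q φ.dual :=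
  ⟨h.1.dual, by simpa using h.2⟩

theorem Mu.ext_dual (h : Mu L φ) : ∀ S : LTS T, φ.dual.ext S.compl = (φ.ext S)ᶜ := by
  induction h with
  | letter q => exact fun S => rfl
  | nletter q => exact fun S => rfl
  | or _ _ ih₁ ih₂ =>
    intro S
    simp only [MuFormula.dual, ext, ih₁, ih₂, Set.compl_union]
  | and _ _ ih₁ ih₂ =>
    intro S
    simp only [MuFormula.dual, ext, ih₁, ih₂, Set.compl_inter]
  | nxt hα _ ih =>
    intro S
    ext s
    refine OneStep.sat_dual (fun i t ht => ?_) _ _ fun x hx => by simp [hα.2.2] at hx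
    change t ∈ S.succ s ∧ _ ↔ ¬ (t ∈ S.succ s ∧ _)
    rw [ih i S]
    have ht' : t ∈ S.succ s := ht
    simp [ht']
  | mu _ _ ih =>
    intro S
    simp only [MuFormula.dual, ext, Set.compl_sInter]
    congr 1
    ext X
    simp only [Set.mem_ofPred_eq, Set.mem_image]
    constructor
    · refine fun hX => ⟨Xᶜ, ?_, _root_.compl_compl X⟩
      rwa [← Set.compl_subset_compl, ← ih, LTS.compl_assign, _root_.compl_compl]
    · rintro ⟨Y, hY, rfl⟩
      rwa [← LTS.compl_assign, ih, Set.compl_subset_compl]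
  | nu _ _ ih =>
    intro S
    simp only [MuFormula.dual, ext, Set.compl_sUnion]
    congr 1
    ext X
    simp only [Set.mem_ofPred_eq, Set.mem_image]
    constructor
    · refine fun hX => ⟨Xᶜ, ?_, _root_.compl_compl X⟩
      rwa [← Set.compl_subset_compl, ← ih, LTS.compl_assign, _root_.compl_compl]
    · rintro ⟨Y, hY, rfl⟩
      rwa [← LTS.compl_assign, ih, Set.compl_subset_compl]

theorem FreeOf.positiveIn (h : FreeOf L Q φ) : ∀ q ∈ Q, φ.PositiveIn q :=
  fun _ hq => positiveIn_of_notMem_free fun h' => Set.disjoint_left.1 h.2 h' hq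

theorem Noe.mu_positiveIn (h : Noe L Q φ) : Mu L φ ∧ ∀ q ∈ Q, φ.PositiveIn q := by
  induction h with
  | letter hq => exact ⟨.letter _, fun _ _ => trivial⟩
  | base h => exact ⟨h.1, h.positiveIn⟩
  | or _ _ ih₁ ih₂ => exact ⟨.or ih₁.1 ih₂.1, fun q hq => ⟨ih₁.2 q hq, ih₂.2 q hq⟩⟩
  | and _ _ ih₁ ih₂ => exact ⟨.and ih₁.1 ih₂.1, fun q hq => ⟨ih₁.2 q hq, ih₂.2 q hq⟩⟩
  | nxt hα _ ih => exact ⟨.nxt hα fun i => (ih i).1, fun q hq i => (ih i).2 q hq⟩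
  | mu _ ih => exact ⟨.mu ih.1 (ih.2 _ (.inr rfl)), fun q hq => .inr (ih.2 q (.inl hq))⟩

theorem Cont.mu_positiveIn (h : Cont L Q φ) : Mu L φ ∧ ∀ q ∈ Q, φ.PositiveIn q := by
  induction h with
  | letter hq => exact ⟨.letter _, fun _ _ => trivial⟩
  | base h => exact ⟨h.1, h.positiveIn⟩
  | or _ _ ih₁ ih₂ => exact ⟨.or ih₁.1 ih₂.1, fun q hq => ⟨ih₁.2 q hq, ih₂.2 q hq⟩⟩
  | and _ _ ih₁ ih₂ => exact ⟨.and ih₁.1 ih₂.1, fun q hq => ⟨ih₁.2 q hq, ih₂.2 q hq⟩⟩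
  | nxt B hα _ h' ih =>
    have key := fun i => (em (i ∈ B)).elim (fun hi => ih i hi)
      fun hi => ⟨(h' i hi).1, (h' i hi).positiveIn⟩
    exact ⟨.nxt (OneStep.Cont.mem_pos hα) fun i => (key i).1, fun q hq i => (key i).2 q hq⟩
  | mu _ ih => exact ⟨.mu ih.1 (ih.2 _ (.inr rfl)), fun q hq => .inr (ih.2 q (.inl hq))⟩

theorem Conoe.dual (h : Conoe L Q φ) : Noe L Q φ.dual := by
  induction h with
  | letter hq => exact .letter hq
  | base h => exact .base h.dual
  | or _ _ ih₁ ih₂ => exact .and ih₁ ih₂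
  | and _ _ ih₁ ih₂ => exact .or ih₁ ih₂
  | nxt hα _ ih => exact .nxt (OneStep.dual_mem_pos hα) ih
  | nu _ ih => exact .mu ih

theorem Cocont.dual (h : Cocont L Q φ) : Cont L Q φ.dual := by
  induction h with
  | letter hq => exact .letter hq
  | base h => exact .base h.dual
  | or _ _ ih₁ ih₂ => exact .and ih₁ ih₂
  | and _ _ ih₁ ih₂ => exact .or ih₁ ih₂
  | nxt B hα _ h' ih => exact .nxt B hα ih fun i hi => (h' i hi).dual
  | nu _ ih => exact .mu ih

theorem MuD.mu_formula (h : MuD L φ) : Mu L φ := by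
  induction h with
  | letter q => exact .letter q
  | nletter q => exact .nletter q
  | or _ _ ih₁ ih₂ => exact .or ih₁ ih₂
  | and _ _ ih₁ ih₂ => exact .and ih₁ ih₂
  | nxt hα _ ih => exact .nxt hα ih
  | mu _ hp ih => exact .mu ih (hp.mu_positiveIn.2 _ rfl)
  | nu _ hp ih => exact .nu ih ((positiveIn_dual _).1 (hp.dual.mu_positiveIn.2 _ rfl))

theorem MuC.mu_formula (h : MuC L φ) : Mu L φ := by
  induction h with
  | letter q => exact .letter q
  | nletter q => exact .nletter q
  | or _ _ ih₁ ih₂ => exact .or ih₁ ih₂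
  | and _ _ ih₁ ih₂ => exact .and ih₁ ih₂
  | nxt hα _ ih => exact .nxt hα ih
  | mu _ hp ih => exact .mu ih (hp.mu_positiveIn.2 _ rfl)
  | nu _ hp ih => exact .nu ih ((positiveIn_dual _).1 (hp.dual.mu_positiveIn.2 _ rfl))

end MuFormula

/-! ### Sets based at a node -/

/-- A family of sets `X`, each based at a node `s`, that contains the singletons and is closed under
binary unions and under attaching to every node of `X` a set based there. -/
structure BasedFamily (G : T → Set T → Prop) : Prop where
  singleton : ∀ s, G s {s}
  union : ∀ {s X Y}, G s X → G s Y → G s (X ∪ Y)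
  bind : ∀ {s X} {Z : T → Set T}, G s X → (∀ t ∈ X, G t (Z t)) → G s (⋃ t ∈ X, Z t)

theorem basedFamily_finite : BasedFamily fun (_ : T) (X : Set T) => X.Finite :=
  ⟨Set.finite_singleton, Set.Finite.union, fun h h' => Set.Finite.biUnion h h'⟩

/-- `X` is contained in a well-founded tree of paths from `s`. The tree is given inductively: it is
empty, or it consists of `s` and of a tree from every successor of `s`. -/
inductive Grounded (R : T → T → Prop) : T → Set T → Prop
  | empty (s : T) : Grounded R s ∅
  | intro {s : T} {X : Set T} (Y : T → Set T) (hY : ∀ t, R s t → Grounded R t (Y t))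
      (hX : ∀ u ∈ X, u = s ∨ ∃ t, R s t ∧ u ∈ Y t) : Grounded R s X

namespace Grounded

variable {R : T → T → Prop} {s : T} {X : Set T}

theorem subset (h : Grounded R s X) {Y : Set T} (hYX : Y ⊆ X) : Grounded R s Y := by
  cases h with
  | empty => rw [Set.subset_empty_iff.1 hYX]; exact .empty s
  | intro Z hZ hX => exact .intro Z hZ fun u hu => hX u (hYX hu)

theorem union (h : Grounded R s X) : ∀ {Y : Set T}, Grounded R s Y → Grounded R s (X ∪ Y) := by
  induction h with
  | empty s => intro Y hY; simpa using hY
  | @intro s X Z hZ hX ih =>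
    rintro Y (_ | ⟨Z', hZ', hY⟩)
    · rw [Set.union_empty]; exact .intro Z hZ hX
    refine .intro (fun t => Z t ∪ Z' t) (fun t ht => ih t ht (hZ' t ht)) ?_
    rintro u (hu | hu)
    · exact (hX u hu).imp_right fun ⟨t, ht, hut⟩ => ⟨t, ht, .inl hut⟩
    · exact (hY u hu).imp_right fun ⟨t, ht, hut⟩ => ⟨t, ht, .inr hut⟩

theorem bind (h : Grounded R s X) : ∀ {Z : T → Set T}, (∀ t ∈ X, Grounded R t (Z t)) →
    Grounded R s (⋃ t ∈ X, Z t) := by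
  induction h with
  | empty s => intro Z _; simpa using .empty s
  | @intro s X Y hY hX ih =>
    intro Z hZ
    have hZ' : ∀ t, Grounded R t (⋃ _ : t ∈ X, Z t) := fun t => by
      by_cases ht : t ∈ X
      · simpa [ht] using hZ t ht
      · simpa [ht] using .empty t
    have htree : Grounded R s (⋃ t ∈ {t | ∃ r, R s r ∧ t ∈ Y r}, ⋃ _ : t ∈ X, Z t) := by
      refine .intro (fun r => ⋃ t ∈ Y r, ⋃ _ : t ∈ X, Z t)
        (fun r hr => ih r hr fun t _ => hZ' t) fun u hu => .inr ?_
      obtain ⟨t, ⟨r, hr, htr⟩, hut⟩ := Set.mem_iUnion₂.1 hu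
      exact ⟨r, hr, Set.mem_iUnion₂.2 ⟨t, htr, hut⟩⟩
    refine ((hZ' s).union htree).subset fun u hu => ?_
    obtain ⟨t, ht, hut⟩ := Set.mem_iUnion₂.1 hu
    rcases hX t ht with rfl | htr
    · exact .inl (Set.mem_iUnion.2 ⟨ht, hut⟩)
    · exact .inr (Set.mem_iUnion₂.2 ⟨t, htr, Set.mem_iUnion.2 ⟨ht, hut⟩⟩)

theorem singleton (s : T) : Grounded R s {s} :=
  .intro (fun _ => ∅) (fun t _ => .empty t) fun _ hu => .inl hu

theorem iUnion_fin {n : ℕ} {Y : Fin n → Set T} (h : ∀ i, Grounded R s (Y i)) :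
    Grounded R s (⋃ i, Y i) := by
  induction n with
  | zero => simpa using .empty s
  | succ n ih =>
    refine ((h 0).union (ih fun i => h i.succ)).subset fun u hu => ?_
    obtain ⟨i, hi⟩ := Set.mem_iUnion.1 hu
    cases i using Fin.cases with
    | zero => exact .inl hi
    | succ i => exact .inr (Set.mem_iUnion.2 ⟨i, hi⟩)

theorem basedFamily (R : T → T → Prop) : BasedFamily (Grounded R) :=
  ⟨singleton, fun h h' => union h h', fun h h' => bind h h'⟩

/-- The trees of paths from the successors of `s`, prolonged to `s`, form the bundle. A strictly
ascending chain in it would have, after its first member, a tail in one of these trees. -/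
theorem exists_bundle (S : LTS T) (h : Grounded S.rel s X) :
    ∃ B : Set (List T), B.Nonempty ∧ (∀ π ∈ B, S.IsPathFrom s π) ∧
      (¬ ∃ f : ℕ → List T, ∀ k, f k ∈ B ∧ f k <+: f (k + 1) ∧ f k ≠ f (k + 1)) ∧
      (∀ π ∈ B, ∀ ρ, ρ ≠ [] → ρ <+: π → ρ ∈ B) ∧ ∀ t ∈ X, ∃ π ∈ B, t ∈ π := by
  induction h with
  | empty s =>
    refine ⟨{[s]}, ⟨_, rfl⟩, ?_, ?_, ?_, fun t ht => ht.elim⟩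
    · rintro π rfl
      simp [LTS.IsPathFrom]
    · rintro ⟨f, hf⟩
      exact (hf 0).2.2 ((hf 0).1.trans (hf 1).1.symm)
    · rintro π rfl ρ hρ h
      rcases List.prefix_cons_iff.1 h with h₁ | ⟨τ, rfl, h₁⟩
      · exact (hρ h₁).elim
      · rw [List.prefix_nil.1 h₁]; rfl
  | @intro s X Y hY hX ih =>
    choose B hne hpath hwf hcl hcov using ih
    refine ⟨{π | π = [s] ∨ ∃ t, ∃ ht : S.rel s t, ∃ ρ ∈ B t ht, π = s :: ρ},
      ⟨_, .inl rfl⟩, ?_, ?_, ?_, ?_⟩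
    · rintro π (rfl | ⟨t, ht, ρ, hρ, rfl⟩)
      · simp [LTS.IsPathFrom]
      · obtain ⟨h₁, h₂⟩ := hpath t ht ρ hρ
        refine ⟨rfl, List.isChain_cons.2 ⟨fun y hy => ?_, h₂⟩⟩
        rw [h₁] at hy
        cases hy
        exact ht
    · rintro ⟨f, hf⟩
      have hlen : ∀ k, (f k).length < (f (k + 1)).length := fun k =>
        lt_of_le_of_ne (hf k).2.1.length_le fun h => (hf k).2.2 ((hf k).2.1.eq_of_length h)
      have hpos : ∀ k, 0 < (f k).length := by
        intro k
        rcases (hf k).1 with h | ⟨t, ht, ρ, _, h⟩ <;> simp [h]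
      -- From the second path on, all paths pass through one and the same successor of `s`.
      have hone : ∀ k, ∃ t, ∃ ht : S.rel s t, ∃ ρ ∈ B t ht, f (k + 1) = s :: ρ := by
        intro k
        refine (hf (k + 1)).1.resolve_left fun h => ?_
        have h₁ := hlen k
        have h₂ := hpos k
        rw [h, List.length_singleton] at h₁
        omega
      choose t ht ρ hρ hfρ using hone
      have hpre : ∀ k, ρ k <+: ρ (k + 1) ∧ ρ k ≠ ρ (k + 1) := by
        intro k
        have := (hf (k + 1)).2
        rw [hfρ k, hfρ (k + 1)] at this
        exact ⟨(List.prefix_cons_inj s).1 this.1, fun h => this.2 (by rw [h])⟩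
      have hsucc : ∀ k, t (k + 1) = t k := by
        intro k
        have h₁ := (hpath _ _ _ (hρ k)).1
        have h₂ := (hpath _ _ _ (hρ (k + 1))).1
        obtain ⟨τ, hτ⟩ := (hpre k).1
        rw [← hτ, List.head?_append, h₁] at h₂
        simpa using h₂.symm
      have hconst : ∀ k, t k = t 0 := fun k => by
        induction k with
        | zero => rfl
        | succ k ihk => rw [hsucc, ihk]
      refine hwf (t 0) (ht 0) ⟨ρ, fun k => ⟨?_, hpre k⟩⟩
      have move : ∀ r, r = t 0 → ∀ hr : S.rel s r, ρ k ∈ B r hr → ρ k ∈ B (t 0) (ht 0) := by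
        rintro _ rfl _ h
        exact h
      exact move _ (hconst k) _ (hρ k)
    · rintro π (rfl | ⟨t, ht, ρ, hρ, rfl⟩) τ hτ h <;>
        rcases List.prefix_cons_iff.1 h with h₁ | ⟨σ, rfl, h₁⟩
      · exact (hτ h₁).elim
      · rw [List.prefix_nil.1 h₁]; exact .inl rfl
      · exact (hτ h₁).elim
      · by_cases hσ : σ = []
        · exact .inl (by rw [hσ])
        · exact .inr ⟨t, ht, σ, hcl t ht ρ hρ σ hσ h₁, rfl⟩
    · intro u hu
      rcases hX u hu with rfl | ⟨t, ht, hut⟩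
      · exact ⟨_, .inl rfl, by simp⟩
      · obtain ⟨ρ, hρ, hur⟩ := hcov t ht u hut
        exact ⟨_, .inr ⟨t, ht, ρ, hρ, rfl⟩, List.mem_cons_of_mem _ hur⟩

theorem wfNoetherian (S : LTS T) (h : Grounded S.rel s X) : S.WfNoetherian X := by
  obtain ⟨B, hne, hpath, hwf, hcl, hcov⟩ := h.exists_bundle S
  exact ⟨B, ⟨hne, ⟨s, hpath⟩, hwf⟩, hcl, hcov⟩

end Grounded

theorem LTS.WfNoetherian.noetherian {S : LTS T} {X : Set T} (h : S.WfNoetherian X) :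
    S.Noetherian X := by
  obtain ⟨B, hB, _, hcov⟩ := h
  exact ⟨B, hB, hcov⟩

/-! ### Localization and restricted prefixpoints -/

namespace MuFormula

variable {R : T → T → Prop} {G : T → Set T → Prop} {L : OneStepLang} {Q : Set ℕ}
  {φ ψ : MuFormula} {p : ℕ}

/-- Over the frame `R`, the truth of `φ` at `s` depends on the letters of `Q` inside some set based
at `s` only. -/
def Localizes (R : T → T → Prop) (G : T → Set T → Prop) (Q : Set ℕ) (φ : MuFormula) : Prop :=
  ∀ S : LTS T, S.rel = R → ∀ s ∈ φ.ext S, ∃ X, G s X ∧ s ∈ φ.ext (S.restrict Q X)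

theorem Mu.ext_restrict_mono (h : Mu L φ) (hpos : ∀ q ∈ Q, φ.PositiveIn q) (S : LTS T)
    {X Y : Set T} (hXY : X ⊆ Y) : φ.ext (S.restrict Q X) ⊆ φ.ext (S.restrict Q Y) := by
  refine h.ext_mono_of_positive hpos rfl (fun q hq t ht => ⟨ht.1, fun _ => hXY (ht.2 hq)⟩) ?_
  intro q hq
  ext t
  simp [LTS.mem_val_restrict, hq]

theorem Mu.ext_assign_mono (h : Mu L φ) (hpos : φ.PositiveIn p) (S : LTS T) {X Y : Set T}
    (hXY : X ⊆ Y) : φ.ext (S.assign p X) ⊆ φ.ext (S.assign p Y) := by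
  refine h.ext_mono_of_positive (Q := {p}) (by simpa using hpos) rfl ?_ ?_
  · rintro q rfl; simpa
  · intro q hq; rw [LTS.val_assign_of_ne _ hq, LTS.val_assign_of_ne _ hq]

theorem FreeOf.ext_restrict (h : FreeOf L Q φ) (S : LTS T) (X : Set T) :
    φ.ext (S.restrict Q X) = φ.ext S := by
  refine h.1.ext_congr rfl fun q hq => ?_
  ext t
  simp [LTS.mem_val_restrict, fun h' => Set.disjoint_left.1 h.2 hq h']

theorem FreeOf.localizes (hG : BasedFamily G) (h : FreeOf L Q φ) : Localizes R G Q φ :=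
  fun S _ s hs => ⟨{s}, hG.singleton s, by rwa [h.ext_restrict]⟩

theorem localizes_letter (hG : BasedFamily G) (q : ℕ) : Localizes R G Q (letter q) :=
  fun _ _ s hs => ⟨{s}, hG.singleton s, hs, fun _ => rfl⟩

theorem Localizes.or (hφ : Localizes R G Q φ) (hψ : Localizes R G Q ψ) :
    Localizes R G Q (or φ ψ) := by
  rintro S hS s (hs | hs)
  · obtain ⟨X, hX, h⟩ := hφ S hS s hs
    exact ⟨X, hX, .inl h⟩
  · obtain ⟨X, hX, h⟩ := hψ S hS s hs
    exact ⟨X, hX, .inr h⟩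

theorem Localizes.and (hG : BasedFamily G) (hφ : Localizes R G Q φ) (hψ : Localizes R G Q ψ)
    (h : Mu L (and φ ψ)) (hpos : ∀ q ∈ Q, (and φ ψ).PositiveIn q) :
    Localizes R G Q (and φ ψ) := by
  obtain _ | _ | _ | ⟨h₁, h₂⟩ := h
  rintro S hS s ⟨hs₁, hs₂⟩
  obtain ⟨X, hX, hX'⟩ := hφ S hS s hs₁
  obtain ⟨Y, hY, hY'⟩ := hψ S hS s hs₂
  exact ⟨X ∪ Y, hG.union hX hY,
    h₁.ext_restrict_mono (fun q hq => (hpos q hq).1) S Set.subset_union_left hX',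
    h₂.ext_restrict_mono (fun q hq => (hpos q hq).2) S Set.subset_union_right hY'⟩

/-- The least fixpoint is reached through localized prefixpoints: the nodes where this holds form a
prefixpoint, since the sets obtained for the nodes of a set `X` based at `t` can be attached to
`X`. -/
theorem Localizes.mu (hG : BasedFamily G) (hφ : Localizes R G (Q ∪ {p}) φ) (h : Mu L φ)
    (hpos : ∀ q ∈ Q ∪ {p}, φ.PositiveIn q) : Localizes R G Q (mu p φ) := by
  intro S hS s hs
  have hmu : Mu L (.mu p φ) := .mu h (hpos p (.inr rfl))
  have hposmu : ∀ q ∈ Q, (MuFormula.mu p φ).PositiveIn q := fun q hq => .inr (hpos q (.inl hq))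
  refine hs {t | ∃ X, G t X ∧ t ∈ (MuFormula.mu p φ).ext (S.restrict Q X)} fun t ht => ?_
  set W := {t | ∃ X, G t X ∧ t ∈ (MuFormula.mu p φ).ext (S.restrict Q X)}
  obtain ⟨X, hX, htX⟩ := hφ (S.assign p W) hS t ht
  have hZ : ∀ u, ∃ Z, G u Z ∧ (u ∈ W → u ∈ (MuFormula.mu p φ).ext (S.restrict Q Z)) := by
    intro u
    by_cases hu : u ∈ W
    · obtain ⟨Z, hZ, hu'⟩ := hu
      exact ⟨Z, hZ, fun _ => hu'⟩
    · exact ⟨{u}, hG.singleton u, fun h => (hu h).elim⟩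
  choose Z hZ hWZ using hZ
  refine ⟨X ∪ ⋃ u ∈ X, Z u, hG.union hX (hG.bind hX fun u _ => hZ u), ?_⟩
  set X' := X ∪ ⋃ u ∈ X, Z u
  have hWX : W ∩ X ⊆ (MuFormula.mu p φ).ext (S.restrict Q X') := fun u hu =>
    hmu.ext_restrict_mono hposmu S
      ((Set.subset_biUnion_of_mem (u := Z) hu.2).trans Set.subset_union_right) (hWZ u hu.1)
  intro P hP
  refine hP (h.ext_mono_of_positive (S := (S.assign p W).restrict (Q ∪ {p}) X)
    (S' := (S.restrict Q X').assign p P) hpos rfl ?_ ?_ htX)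
  · intro q hq u hu
    rw [LTS.mem_val_restrict] at hu
    by_cases hqp : q = p
    · subst hqp
      rw [LTS.val_assign_self] at hu ⊢
      exact hWX ⟨hu.1, hu.2 hq⟩ P hP
    · rw [LTS.val_assign_of_ne _ hqp] at hu ⊢
      exact ⟨hu.1, fun _ => .inl (hu.2 hq)⟩
  · intro q hq
    have hqp : q ≠ p := fun e => hq (.inr e)
    ext u
    rw [LTS.mem_val_restrict, LTS.val_assign_of_ne _ hqp, LTS.val_assign_of_ne _ hqp,
      LTS.mem_val_restrict]
    exact and_congr_right fun _ =>
      ⟨fun _ hq' => (hq (.inl hq')).elim, fun _ hq' => (hq hq').elim⟩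

theorem Noe.localizes (h : Noe L Q φ) : Localizes R (Grounded R) Q φ := by
  have hG := Grounded.basedFamily R
  induction h with
  | letter hq => exact localizes_letter hG _
  | base h => exact h.localizes hG
  | or _ _ ih₁ ih₂ => exact ih₁.or ih₂
  | and h₁ h₂ ih₁ ih₂ =>
    have := (h₁.and h₂).mu_positiveIn
    exact ih₁.and hG ih₂ this.1 this.2
  | @nxt Q n α φ hα h ih =>
    rintro S rfl s hs
    have hY : ∀ t i, ∃ Y, Grounded S.rel t Y ∧ (t ∈ (φ i).ext S →
        t ∈ (φ i).ext (S.restrict Q Y)) := by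
      intro t i
      by_cases ht : t ∈ (φ i).ext S
      · obtain ⟨Y, hY, ht'⟩ := ih i S rfl t ht
        exact ⟨Y, hY, fun _ => ht'⟩
      · exact ⟨∅, .empty t, fun h => (ht h).elim⟩
    choose Y hY hφY using hY
    refine ⟨{u | ∃ t, S.rel s t ∧ u ∈ ⋃ i, Y t i}, .intro (fun t => ⋃ i, Y t i)
      (fun t _ => .iUnion_fin (hY t)) fun u hu => .inr hu, ?_⟩
    refine OneStep.Sat.mono (D := S.succ s) hα.2.1 ?_ hs
    refine fun i _ t ht => ⟨ht.1, (h i).mu_positiveIn.1.ext_restrict_mono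
      (h i).mu_positiveIn.2 S ?_ (hφY t i ht.2)⟩
    exact fun u hu => ⟨t, ht.1, Set.mem_iUnion.2 ⟨i, hu⟩⟩
  | mu h ih => exact ih.mu hG h.mu_positiveIn.1 h.mu_positiveIn.2

theorem Cont.localizes (h : Cont L Q φ) : Localizes R (fun _ X => X.Finite) Q φ := by
  have hG := basedFamily_finite (T := T)
  induction h with
  | letter hq => exact localizes_letter hG _
  | base h => exact h.localizes hG
  | or _ _ ih₁ ih₂ => exact ih₁.or ih₂
  | and h₁ h₂ ih₁ ih₂ =>
    have := (h₁.and h₂).mu_positiveIn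
    exact ih₁.and hG ih₂ this.1 this.2
  | @nxt Q n α φ B hα h h' ih =>
    rintro S rfl s hs
    obtain ⟨U, hU, hsU⟩ := hα.1.exists_finite _ _ hs
    have hY : ∀ t i, ∃ Y : Set T, Y.Finite ∧ (i ∈ B → t ∈ (φ i).ext S →
        t ∈ (φ i).ext (S.restrict Q Y)) := by
      intro t i
      by_cases ht : i ∈ B ∧ t ∈ (φ i).ext S
      · obtain ⟨Y, hY, ht'⟩ := ih i ht.1 S rfl t ht.2
        exact ⟨Y, hY, fun _ _ => ht'⟩
      · exact ⟨∅, Set.finite_empty, fun h₁ h₂ => (ht ⟨h₁, h₂⟩).elim⟩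
    choose Y hY hφY using hY
    refine ⟨⋃ t ∈ U, ⋃ i, Y t i, Set.Finite.biUnion hU fun t _ => Set.finite_iUnion (hY t), ?_⟩
    refine OneStep.Sat.mono (D := S.succ s) (OneStep.Cont.mem_pos hα).2.1 ?_ hsU
    rintro i _ t ⟨⟨ht₁, ht₂⟩, htU⟩
    refine ⟨ht₁, ?_⟩
    by_cases hi : i ∈ B
    · refine (h i hi).mu_positiveIn.1.ext_restrict_mono (h i hi).mu_positiveIn.2 S ?_
        (hφY t i hi ht₂)
      exact (Set.subset_iUnion (Y t) i).trans
        (Set.subset_biUnion_of_mem (u := fun t => ⋃ i, Y t i) (htU hi))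
    · rwa [(h' i hi).ext_restrict]
  | mu h ih => exact ih.mu hG h.mu_positiveIn.1 h.mu_positiveIn.2

/-- The least fixpoint `μp.φ` is reached through prefixpoints restricted to sets in `K`. -/
def MuRestricts (K : LTS T → Set T → Prop) (p : ℕ) (φ : MuFormula) : Prop :=
  ∀ S : LTS T, ∀ s, s ∈ (mu p φ).ext S ↔
    ∃ X, K S X ∧ ∀ P ⊆ X, φ.ext (S.assign p P) ∩ X ⊆ P → s ∈ P

/-- The dual property of the greatest fixpoint `νp.φ`. The sets `P` approximate its complement. -/
def NuRestricts (K : LTS T → Set T → Prop) (p : ℕ) (φ : MuFormula) : Prop :=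
  ∀ S : LTS T, ∀ s, s ∉ (nu p φ).ext S ↔
    ∃ X, K S X ∧ ∀ P ⊆ X, (φ.ext (S.assign p Pᶜ))ᶜ ∩ X ⊆ P → s ∈ P

/-- As in `Localizes.mu`, the nodes where this holds form a prefixpoint. -/
theorem Localizes.exists_restricted (hG : BasedFamily G) (hφ : Localizes R G {p} φ) (h : Mu L φ)
    (hpos : φ.PositiveIn p) (S : LTS T) (hS : S.rel = R) {s : T}
    (hs : s ∈ (MuFormula.mu p φ).ext S) :
    ∃ X, G s X ∧ ∀ P ⊆ X, φ.ext (S.assign p P) ∩ X ⊆ P → s ∈ P := by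
  refine hs {s | ∃ X, G s X ∧ ∀ P ⊆ X, φ.ext (S.assign p P) ∩ X ⊆ P → s ∈ P} fun t ht => ?_
  set W := {s | ∃ X, G s X ∧ ∀ P ⊆ X, φ.ext (S.assign p P) ∩ X ⊆ P → s ∈ P}
  obtain ⟨X, hX, htX⟩ := hφ (S.assign p W) hS t ht
  have hZ : ∀ u, ∃ Z, G u Z ∧
      (u ∈ W → ∀ P ⊆ Z, φ.ext (S.assign p P) ∩ Z ⊆ P → u ∈ P) := by
    intro u
    by_cases hu : u ∈ W
    · obtain ⟨Z, hZ, hu'⟩ := hu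
      exact ⟨Z, hZ, fun _ => hu'⟩
    · exact ⟨{u}, hG.singleton u, fun h => (hu h).elim⟩
  choose Z hZ hWZ using hZ
  refine ⟨{t} ∪ (X ∪ ⋃ u ∈ X, Z u),
    hG.union (hG.singleton t) (hG.union hX (hG.bind hX fun u _ => hZ u)), fun P hPX hP => ?_⟩
  refine hP ⟨h.ext_mono_of_positive (S := (S.assign p W).restrict {p} X)
    (S' := S.assign p P) (Q := {p}) (by simpa using hpos) rfl ?_ ?_ htX, .inl rfl⟩
  · rintro q rfl u hu
    rw [LTS.mem_val_restrict] at hu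
    rw [LTS.val_assign_self] at hu ⊢
    have huX := hu.2 rfl
    -- A prefixpoint restricted to the large set yields one restricted to `Z u`.
    refine (hWZ u hu.1 (P ∩ Z u) Set.inter_subset_right fun v hv => ⟨hP ⟨?_, ?_⟩, hv.2⟩).1
    · exact h.ext_assign_mono hpos S Set.inter_subset_left hv.1
    · exact .inr (.inr (Set.mem_biUnion huX hv.2))
  · intro q hq
    ext u
    rw [LTS.mem_val_restrict, LTS.val_assign_of_ne _ hq, LTS.val_assign_of_ne _ hq]
    simp [show q ∉ ({p} : Set ℕ) from hq]

theorem Localizes.muRestricts {K : LTS T → Set T → Prop} {G : LTS T → T → Set T → Prop}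
    (hG : ∀ S, BasedFamily (G S)) (hGK : ∀ S s X, G S s X → K S X)
    (hφ : ∀ S, Localizes S.rel (G S) {p} φ) (h : Mu L φ) (hpos : φ.PositiveIn p) :
    MuRestricts K p φ := by
  refine fun S s => ⟨fun hs => ?_, ?_⟩
  · obtain ⟨X, hX, hX'⟩ := (hφ S).exists_restricted (hG S) h hpos S rfl hs
    exact ⟨X, hGK _ _ _ hX, hX'⟩
  · rintro ⟨X, -, hX⟩ P hP
    refine (hX (P ∩ X) Set.inter_subset_right fun u hu => ⟨hP ?_, hu.2⟩).1
    exact h.ext_assign_mono hpos S Set.inter_subset_left hu.1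

theorem MuRestricts.nuRestricts {K : LTS T → Set T → Prop}
    (hK : ∀ {S S' : LTS T}, S.rel = S'.rel → ∀ {X}, K S X → K S' X) (h : Mu L (nu p φ))
    (hφ : MuRestricts K p φ.dual) : NuRestricts K p φ := by
  intro S s
  have hφ' : Mu L φ := by cases h; assumption
  rw [← Set.mem_compl_iff, ← h.ext_dual, dual, hφ]
  have key : ∀ P, φ.dual.ext (S.compl.assign p P) = (φ.ext (S.assign p Pᶜ))ᶜ := fun P => by
    rw [← hφ'.ext_dual, LTS.compl_assign, compl_compl]
  simp only [key]
  exact exists_congr fun X => and_congr_left fun _ => 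
    ⟨hK (S := S.compl) (S' := S) rfl, hK (S := S) (S' := S.compl) rfl⟩

end MuFormula

/-! ### Letters and abbreviations of the target formulas -/

@[simp] theorem LTS.rel_assign (S : LTS T) (p : ℕ) (X : Set T) : (S.assign p X).rel = S.rel := rfl

/-- The letter that holds the current node. All letters bound in the translation are at least `M`,
so that they differ from the letters of the source formula. -/
def nodeLetter (M : ℕ) : ℕ := M

/-- The letter for the sets that restrict prefixpoints, and for those that witness finiteness. -/
def rangeLetter (M : ℕ) : ℕ := M + 1

/-- The letter that replaces the letter `p` inside the scope of a fixpoint operator for `p`. -/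
def fixLetter (M p : ℕ) : ℕ := M + 4 + 2 * p

/-- The letter that replaces the individual variable `x` of a one-step formula. -/
def varLetter (M x : ℕ) : ℕ := M + 5 + 2 * x

theorem fixLetter_injective (M : ℕ) : Function.Injective (fixLetter M) := by
  intro p q h; simp only [fixLetter] at h; omega

theorem varLetter_injective (M : ℕ) : Function.Injective (varLetter M) := by
  intro p q h; simp only [varLetter] at h; omega

theorem fixLetter_ne_varLetter (M p x : ℕ) : fixLetter M p ≠ varLetter M x := by
  simp only [fixLetter, varLetter]; omega

theorem fixLetter_ne_nodeLetter (M p : ℕ) : fixLetter M p ≠ nodeLetter M := by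
  simp only [fixLetter, nodeLetter]; omega

theorem fixLetter_ne_rangeLetter (M p : ℕ) : fixLetter M p ≠ rangeLetter M := by
  simp only [fixLetter, rangeLetter]; omega

theorem varLetter_ne_nodeLetter (M p : ℕ) : varLetter M p ≠ nodeLetter M := by
  simp only [varLetter, nodeLetter]; omega

theorem varLetter_ne_rangeLetter (M p : ℕ) : varLetter M p ≠ rangeLetter M := by
  simp only [varLetter, rangeLetter]; omega

theorem rangeLetter_ne_nodeLetter (M : ℕ) : rangeLetter M ≠ nodeLetter M := by
  simp only [rangeLetter, nodeLetter]; omega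

/-- The properties of the quantifier range `K` on which the translation relies. -/
structure Admissible (K : LTS T → Set T → Prop) : Prop where
  congr : ∀ {S S' : LTS T}, S.rel = S'.rel → ∀ {X}, K S X → K S' X
  subset : ∀ {S X Y}, K S X → Y ⊆ X → K S Y
  singleton : ∀ S s, K S {s}

namespace MSO

/-- Conjunction. -/
def and (φ ψ : MSO) : MSO := neg (or (neg φ) (neg ψ))

/-- Universal quantification. -/
def all (p : ℕ) (φ : MSO) : MSO := neg (ex p (neg φ))

/-- The letter `x` denotes a singleton: it is not contained in every set, but each of its subsets
contains it or is contained in every set. The letters `M + 2` and `M + 3` are used only here. -/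
def sing (M x : ℕ) : MSO :=
  and (neg (all (M + 2) (sub x (M + 2))))
    (all (M + 2) (or (neg (sub (M + 2) x))
      (or (sub x (M + 2)) (all (M + 3) (sub (M + 2) (M + 3))))))

/-- Quantification over a single node. -/
def exNode (M x : ℕ) (φ : MSO) : MSO := ex x (and (sing M x) φ)

/-- Quantification over the successors of the current node. -/
def exSucc (M x : ℕ) (φ : MSO) : MSO :=
  exNode M (varLetter M x) (and (rel (nodeLetter M) (varLetter M x)) φ)

/-- Some set in the range of the quantifiers contains the successors that satisfy `φ`. -/
def cover (M x : ℕ) (φ : MSO) : MSO :=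
  ex (rangeLetter M)
    (neg (exSucc M x (and φ (neg (sub (varLetter M x) (rangeLetter M))))))

/-- For some set `X`, the current node lies in every prefixpoint `P ⊆ X` of the map `P ↦ φ ∩ X`. -/
def lfp (M p : ℕ) (φ : MSO) : MSO :=
  ex (rangeLetter M) (all (fixLetter M p)
    (or (neg (sub (fixLetter M p) (rangeLetter M)))
      (or (exNode M (nodeLetter M) (and (sub (nodeLetter M) (rangeLetter M))
          (and φ (neg (sub (nodeLetter M) (fixLetter M p))))))
        (sub (nodeLetter M) (fixLetter M p)))))

section Sat

variable {K : LTS T → Set T → Prop} {S : LTS T} {M x p : ℕ} {φ ψ : MSO}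

@[simp] theorem sat_neg : (neg φ).Sat K S ↔ ¬ φ.Sat K S := Iff.rfl

@[simp] theorem sat_or : (or φ ψ).Sat K S ↔ φ.Sat K S ∨ ψ.Sat K S := Iff.rfl

@[simp] theorem sat_sub {q : ℕ} : (sub p q).Sat K S ↔ S.val p ⊆ S.val q := Iff.rfl

@[simp] theorem sat_ex : (ex p φ).Sat K S ↔ ∃ X, K S X ∧ φ.Sat K (S.assign p X) := Iff.rfl

@[simp] theorem sat_and : (and φ ψ).Sat K S ↔ φ.Sat K S ∧ ψ.Sat K S := by
  simp [and]

@[simp] theorem sat_all : (all p φ).Sat K S ↔ ∀ X, K S X → φ.Sat K (S.assign p X) := by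
  simp [all]

theorem sat_sing (hK : Admissible K) (hx : x ≠ M + 2) :
    (sing M x).Sat K S ↔ ∃ s, S.val x = {s} := by
  have hempty : ∀ S : LTS T, K S ∅ := fun S =>
    hK.subset (hK.singleton S S.root) (Set.empty_subset _)
  have h₁ : ∀ X, (S.assign (M + 2) X).val x = S.val x := fun X => S.val_assign_of_ne hx X
  have h₂ : ∀ X Y, ((S.assign (M + 2) X).assign (M + 3) Y).val (M + 2) = X := fun X Y => by
    rw [LTS.val_assign_of_ne _ (by omega), LTS.val_assign_self]
  simp only [sing, sat_and, sat_neg, sat_all, sat_or, sat_sub, LTS.val_assign_self, h₁, h₂]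
  constructor
  · rintro ⟨hne, h⟩
    obtain ⟨X, hX⟩ := not_forall.1 hne
    obtain ⟨s, hs, -⟩ := Set.not_subset.1 (Classical.not_imp.1 hX).2
    refine ⟨s, Set.Subset.antisymm ?_ (Set.singleton_subset_iff.2 hs)⟩
    rcases h {s} (hK.singleton S s) with h | h | h
    · exact (h (Set.singleton_subset_iff.2 hs)).elim
    · exact h
    · exact (h ∅ (hempty _) rfl).elim
  · rintro ⟨s, hs⟩
    rw [hs]
    refine ⟨fun h => h ∅ (hempty _) rfl, fun X _ => ?_⟩
    by_cases hX : X ⊆ {s}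
    · rcases Set.subset_singleton_iff_eq.1 hX with rfl | rfl
      · exact .inr (.inr fun Y _ => Set.empty_subset Y)
      · exact .inr (.inl subset_rfl)
    · exact .inl hX

theorem sat_exNode (hK : Admissible K) (hx : x ≠ M + 2) :
    (exNode M x φ).Sat K S ↔ ∃ s, φ.Sat K (S.assign x {s}) := by
  simp only [exNode, sat_ex, sat_and, sat_sing hK hx, LTS.val_assign_self]
  constructor
  · rintro ⟨_, -, ⟨s, rfl⟩, h⟩
    exact ⟨s, h⟩
  · rintro ⟨s, h⟩
    exact ⟨{s}, hK.singleton S s, ⟨s, rfl⟩, h⟩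

theorem sat_exNode_nodeLetter (hK : Admissible K) :
    (exNode M (nodeLetter M) φ).Sat K S ↔ ∃ s, φ.Sat K (S.assign (nodeLetter M) {s}) :=
  sat_exNode hK (by simp only [nodeLetter]; omega)

theorem sat_exSucc (hK : Admissible K) {s : T} (hs : S.val (nodeLetter M) = {s}) :
    (exSucc M x φ).Sat K S ↔ ∃ t ∈ S.succ s, φ.Sat K (S.assign (varLetter M x) {t}) := by
  rw [exSucc, sat_exNode hK (by simp only [varLetter]; omega)]
  refine exists_congr fun t => ?_
  simp [Sat, LTS.val_assign_of_ne _ (varLetter_ne_nodeLetter M x).symm, hs, LTS.succ]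

theorem sat_cover (hK : Admissible K) {s : T} (hs : S.val (nodeLetter M) = {s}) :
    (cover M x φ).Sat K S ↔ ∃ X, K S X ∧ ∀ t ∈ S.succ s,
      φ.Sat K ((S.assign (rangeLetter M) X).assign (varLetter M x) {t}) → t ∈ X := by
  refine exists_congr fun X => and_congr_right fun _ => ?_
  have hs' : (S.assign (rangeLetter M) X).val (nodeLetter M) = {s} := by
    rwa [LTS.val_assign_of_ne _ (rangeLetter_ne_nodeLetter M).symm]
  rw [sat_neg, sat_exSucc hK hs']
  simp [LTS.val_assign_of_ne _ (varLetter_ne_rangeLetter M x).symm, LTS.succ]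

theorem sat_lfp (hK : Admissible K) {s : T} (hs : S.val (nodeLetter M) = {s}) :
    (lfp M p φ).Sat K S ↔ ∃ X, K S X ∧ ∀ P ⊆ X,
      (∀ t ∈ X, φ.Sat K (((S.assign (rangeLetter M) X).assign (fixLetter M p) P).assign
        (nodeLetter M) {t}) → t ∈ P) → s ∈ P := by
  refine exists_congr fun X => and_congr_right fun hX => ?_
  have h₁ := (fixLetter_ne_rangeLetter M p).symm
  have h₂ := rangeLetter_ne_nodeLetter M
  have h₃ := fixLetter_ne_nodeLetter M p
  simp only [sat_all, sat_or, sat_neg, sat_sub, sat_exNode_nodeLetter hK, sat_and,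
    LTS.val_assign_self, LTS.val_assign_of_ne _ h₁, LTS.val_assign_of_ne _ h₂,
    LTS.val_assign_of_ne _ h₃, LTS.val_assign_of_ne _ h₂.symm, LTS.val_assign_of_ne _ h₃.symm, hs,
    Set.singleton_subset_iff]
  constructor
  · intro h P hP hclosed
    have hKP := hK.congr (S := S) (S' := S.assign (rangeLetter M) X) rfl (hK.subset hX hP)
    rcases h P hKP with h | ⟨t, ht, h, hn⟩ | h
    · exact (h hP).elim
    · exact (hn (hclosed t ht h)).elim
    · exact h
  · intro h P _
    by_contra! hn
    exact hn.2.2 (h P hn.1 hn.2.1)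

end Sat

section Letters

variable {M x p q : ℕ} {φ : MSO}

theorem mem_free_sing (h : q ∈ (sing M x).free) : q = x := by
  simp only [sing, and, all, free, Set.mem_union, Set.mem_sdiff, Set.mem_insert_iff,
    Set.mem_singleton_iff] at h
  omega

theorem mem_free_exNode (h : q ∈ (exNode M x φ).free) : q ∈ φ.free ∧ q ≠ x := by
  obtain ⟨h₁ | h₁, h₂⟩ := h
  · exact (h₂ (mem_free_sing h₁)).elim
  · exact ⟨h₁, h₂⟩

theorem mem_free_exSucc (h : q ∈ (exSucc M x φ).free) :
    q = nodeLetter M ∨ q ∈ φ.free ∧ q ≠ varLetter M x := by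
  obtain ⟨(h₁ | h₁) | h₁, h₂⟩ := mem_free_exNode h
  · exact .inl h₁
  · exact (h₂ h₁).elim
  · exact .inr ⟨h₁, h₂⟩

theorem mem_free_cover (h : q ∈ (cover M x φ).free) :
    q = nodeLetter M ∨ q ∈ φ.free ∧ q ≠ varLetter M x := by
  obtain ⟨h₁, h₂⟩ := h
  rcases mem_free_exSucc h₁ with h₁ | ⟨h₁ | h₁ | h₁, h₃⟩
  · exact .inl h₁
  · exact .inr ⟨h₁, h₃⟩
  · exact (h₃ h₁).elim
  · exact (h₂ h₁).elim

theorem mem_free_lfp (h : q ∈ (lfp M p φ).free) :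
    q = nodeLetter M ∨ q ∈ φ.free ∧ q ≠ fixLetter M p := by
  obtain ⟨⟨h₁, h₂⟩, h₃⟩ := h
  rcases h₁ with (h₁ | h₁) | h₁ | h₁ | h₁
  · exact (h₂ h₁).elim
  · exact (h₃ h₁).elim
  · obtain ⟨(h₄ | h₄) | h₄ | h₄ | h₄, h₅⟩ := mem_free_exNode h₁
    · exact .inl h₄
    · exact (h₃ h₄).elim
    · exact .inr ⟨h₄, h₂⟩
    · exact .inl h₄
    · exact (h₂ h₄).elim
  · exact .inl h₁
  · exact (h₂ h₁).elim

theorem le_bound_exNode (hx : M ≤ x) (h : ∀ q ∈ φ.bound, M ≤ q) :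
    ∀ q ∈ (exNode M x φ).bound, M ≤ q := by
  intro q hq
  have hsing : q ∈ (sing M x).bound → M ≤ q := fun hq => by
    simp only [sing, and, all, bound, Set.mem_union, Set.mem_insert_iff,
      Set.mem_empty_iff_false, or_false, false_or] at hq
    omega
  rcases hq with rfl | hq | hq
  · exact hx
  · exact hsing hq
  · exact h q hq

theorem le_bound_exSucc (h : ∀ q ∈ φ.bound, M ≤ q) : ∀ q ∈ (exSucc M x φ).bound, M ≤ q :=
  le_bound_exNode (by simp only [varLetter]; omega) fun q hq => Or.elim hq False.elim (h q)

theorem le_bound_cover (h : ∀ q ∈ φ.bound, M ≤ q) : ∀ q ∈ (cover M x φ).bound, M ≤ q := by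
  rintro q (rfl | hq)
  · simp only [rangeLetter]; omega
  · refine le_bound_exSucc (fun q hq => ?_) q hq
    exact Or.elim hq (h q) False.elim

theorem le_bound_lfp (h : ∀ q ∈ φ.bound, M ≤ q) : ∀ q ∈ (lfp M p φ).bound, M ≤ q := by
  rintro q (rfl | rfl | h' | hq | h')
  · simp only [rangeLetter]; omega
  · simp only [fixLetter]; omega
  · exact h'.elim
  · refine le_bound_exNode le_rfl (fun q hq => ?_) q hq
    rcases hq with hq | hq | hq
    · exact hq.elim
    · exact h q hq
    · exact hq.elim
  · exact h'.elim

end Letters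

end MSO

/-! ### The translation of one-step formulas -/

namespace OneStep

variable {A : Type} {M : ℕ}

/-- The translation of a one-step formula about the successors of the current node, where `Φ a`
defines the predicate `a` at the current node. The letter for the current node is bound again inside
`Φ a`, and so may be those for variables and ranges, since `Φ a` refers to none of their values
outside. -/
def toMSO (M : ℕ) (Φ : A → MSO) : OneStep A → MSO
  | pred a x => .exNode M (nodeLetter M) (.and (.sub (nodeLetter M) (varLetter M x)) (Φ a))
  | npred a x =>
      .neg (.exNode M (nodeLetter M) (.and (.sub (nodeLetter M) (varLetter M x)) (Φ a)))
  | eq x y => .sub (varLetter M x) (varLetter M y)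
  | neq x y => .neg (.sub (varLetter M x) (varLetter M y))
  | or α β => .or (α.toMSO M Φ) (β.toMSO M Φ)
  | and α β => .and (α.toMSO M Φ) (β.toMSO M Φ)
  | ex x α => .exSucc M x (α.toMSO M Φ)
  | all x α => .neg (.exSucc M x (.neg (α.toMSO M Φ)))
  | exInf x α => .neg (.cover M x (α.toMSO M Φ))
  | allInf x α => .cover M x (.neg (α.toMSO M Φ))

/-- The systems `S` and `S'` interpret alike the letters through which the translation of a formula
depends on its context, apart from the current node. -/
def Agree (M : ℕ) (S S' : LTS T) : Prop :=
  S.rel = S'.rel ∧ ∀ q, (q < M ∨ ∃ p, q = fixLetter M p) → S.val q = S'.val q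

theorem Agree.assign {S S' : LTS T} (h : Agree M S S') {r : ℕ} (hr : M ≤ r)
    (hr' : ∀ p, fixLetter M p ≠ r) (X : Set T) : Agree M S (S'.assign r X) := by
  refine ⟨h.1, fun q hq => ?_⟩
  rw [LTS.val_assign_of_ne]
  · exact h.2 q hq
  · rcases hq with hq | ⟨p, rfl⟩
    · omega
    · exact hr' p

theorem Agree.assign_node {S S' : LTS T} (h : Agree M S S') (X : Set T) :
    Agree M S (S'.assign (nodeLetter M) X) :=
  h.assign le_rfl (fixLetter_ne_nodeLetter M) X

theorem Agree.assign_var {S S' : LTS T} (h : Agree M S S') (x : ℕ) (X : Set T) :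
    Agree M S (S'.assign (varLetter M x) X) :=
  h.assign (by simp only [varLetter]; omega) (fun p => fixLetter_ne_varLetter M p x) X

theorem Agree.assign_range {S S' : LTS T} (h : Agree M S S') (X : Set T) :
    Agree M S (S'.assign (rangeLetter M) X) :=
  h.assign (by simp only [rangeLetter]; omega) (fixLetter_ne_rangeLetter M) X

theorem sat_toMSO {K : LTS T → Set T → Prop} (hK : Admissible K) {Φ : A → MSO} {W : A → Set T}
    {S₀ : LTS T} (s : T)
    (hΦ : ∀ a S t, Agree M S₀ S → S.val (nodeLetter M) = {t} → ((Φ a).Sat K S ↔ t ∈ W a))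
    {α : OneStep A} (hα : α.FirstOrder ∨ ∀ S X, K S X ↔ X.Finite) :
    ∀ (S : LTS T) (g : ℕ → T), Agree M S₀ S → S.val (nodeLetter M) = {s} →
      (∀ x ∈ α.free, g x ∈ S₀.succ s ∧ S.val (varLetter M x) = {g x}) →
      ((α.toMSO M Φ).Sat K S ↔
        α.Sat (S₀.succ s) (fun a => {t | t ∈ S₀.succ s ∧ t ∈ W a}) g) := by
  have hpred : ∀ (a : A) (x : ℕ) (S : LTS T) (g : ℕ → T), Agree M S₀ S →
      g x ∈ S₀.succ s ∧ S.val (varLetter M x) = {g x} →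
      ((MSO.exNode M (nodeLetter M)
        (.and (.sub (nodeLetter M) (varLetter M x)) (Φ a))).Sat K S ↔
        g x ∈ {t | t ∈ S₀.succ s ∧ t ∈ W a}) := by
    intro a x S g hS hx
    rw [MSO.sat_exNode_nodeLetter hK]
    simp only [MSO.sat_and, MSO.sat_sub, LTS.val_assign_self,
      LTS.val_assign_of_ne _ (varLetter_ne_nodeLetter M x), hx.2]
    constructor
    · rintro ⟨t, ht, h⟩
      rw [hΦ a _ t (hS.assign_node _) (LTS.val_assign_self ..)] at h
      rw [← Set.singleton_subset_singleton.1 ht] at hx ⊢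
      exact ⟨hx.1, h⟩
    · exact fun h => ⟨g x, subset_rfl,
        (hΦ a _ _ (hS.assign_node _) (LTS.val_assign_self ..)).2 h.2⟩
  have hbinder : ∀ {F : Set ℕ} {x : ℕ} {S : LTS T} {g : ℕ → T} {t : T}, t ∈ S₀.succ s →
      (∀ y ∈ F \ {x}, g y ∈ S₀.succ s ∧ S.val (varLetter M y) = {g y}) → ∀ y ∈ F,
      Function.update g x t y ∈ S₀.succ s ∧
        (S.assign (varLetter M x) {t}).val (varLetter M y) = {Function.update g x t y} := by
    intro F x S g t ht h y hy
    by_cases hyx : y = x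
    · subst hyx; simpa using ht
    · rw [LTS.val_assign_of_ne _ ((varLetter_injective M).ne hyx), Function.update_of_ne hyx]
      exact h y ⟨hy, hyx⟩
  have hnode : ∀ {S : LTS T} (x : ℕ) (t : T), S.val (nodeLetter M) = {s} →
      (S.assign (varLetter M x) {t}).val (nodeLetter M) = {s} := fun x t h => by
    rwa [LTS.val_assign_of_ne _ (varLetter_ne_nodeLetter M x).symm]
  have hnode' : ∀ {S : LTS T} (X : Set T), S.val (nodeLetter M) = {s} →
      (S.assign (rangeLetter M) X).val (nodeLetter M) = {s} := fun X h => by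
    rwa [LTS.val_assign_of_ne _ (rangeLetter_ne_nodeLetter M).symm]
  have hrange : ∀ {F : Set ℕ} {S : LTS T} {g : ℕ → T} (X : Set T),
      (∀ y ∈ F, g y ∈ S₀.succ s ∧ S.val (varLetter M y) = {g y}) → ∀ y ∈ F, g y ∈ S₀.succ s ∧
        (S.assign (rangeLetter M) X).val (varLetter M y) = {g y} := by
    intro F S g X h y hy
    rw [LTS.val_assign_of_ne _ (varLetter_ne_rangeLetter M y)]
    exact h y hy
  have hsucc : ∀ {S : LTS T}, Agree M S₀ S → S.succ s = S₀.succ s := fun hS => by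
    simp only [LTS.succ, hS.1]
  -- A finite set covers the successors that satisfy `ψ` exactly if there are finitely many.
  have hcover : (∀ S X, K S X ↔ X.Finite) → ∀ {ψ : MSO} {D : Set T} {x : ℕ} {S : LTS T},
      Agree M S₀ S → S.val (nodeLetter M) = {s} →
      (∀ X, ∀ t ∈ S₀.succ s, ψ.Sat K ((S.assign (rangeLetter M) X).assign (varLetter M x) {t}) ↔
        t ∈ D) → ((MSO.cover M x ψ).Sat K S ↔ {t ∈ S₀.succ s | t ∈ D}.Finite) := by
    intro hfin ψ D x S hS hs hψ
    rw [MSO.sat_cover hK hs, hsucc hS]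
    simp only [hfin]
    constructor
    · rintro ⟨X, hX, h⟩
      exact hX.subset fun t ht => h t ht.1 ((hψ X t ht.1).2 ht.2)
    · exact fun h => ⟨_, h, fun t ht ht' => ⟨ht, (hψ _ t ht).1 ht'⟩⟩
  induction α with
  | pred a x => exact fun S g hS _ hg => hpred a x S g hS (hg x rfl)
  | npred a x => exact fun S g hS _ hg => not_congr (hpred a x S g hS (hg x rfl))
  | eq x y =>
    intro S g _ _ hg
    simp [toMSO, Sat, (hg x (.inl rfl)).2, (hg y (.inr rfl)).2]
  | neq x y =>
    intro S g _ _ hg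
    simp [toMSO, Sat, (hg x (.inl rfl)).2, (hg y (.inr rfl)).2]
  | or α β iha ihb =>
    intro S g hS hs hg
    exact or_congr (iha (hα.imp_left And.left) S g hS hs fun x hx => hg x (.inl hx))
      (ihb (hα.imp_left And.right) S g hS hs fun x hx => hg x (.inr hx))
  | and α β iha ihb =>
    intro S g hS hs hg
    rw [toMSO, MSO.sat_and]
    exact and_congr (iha (hα.imp_left And.left) S g hS hs fun x hx => hg x (.inl hx))
      (ihb (hα.imp_left And.right) S g hS hs fun x hx => hg x (.inr hx))
  | ex x α ih =>
    intro S g hS hs hg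
    rw [toMSO, MSO.sat_exSucc hK hs, hsucc hS]
    exact exists_congr fun t => and_congr_right fun ht =>
      ih hα _ _ (hS.assign_var x _) (hnode x t hs) (hbinder ht hg)
  | all x α ih =>
    intro S g hS hs hg
    rw [toMSO, MSO.sat_neg, MSO.sat_exSucc hK hs, hsucc hS]
    simp only [MSO.sat_neg, not_exists, not_and, not_not]
    exact forall₂_congr fun t ht =>
      ih hα _ _ (hS.assign_var x _) (hnode x t hs) (hbinder ht hg)
  | exInf x α ih =>
    intro S g hS hs hg
    rw [toMSO, MSO.sat_neg]
    refine not_congr (hcover (hα.resolve_left id) (D := {t | α.Sat _ _ (Function.update g x t)})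
      hS hs fun X t ht => ?_)
    exact ih (.inr (hα.resolve_left id)) _ _ ((hS.assign_range X).assign_var x _)
      (hnode x t (hnode' X hs)) (hbinder ht (hrange X hg))
  | allInf x α ih =>
    intro S g hS hs hg
    refine hcover (hα.resolve_left id) (D := {t | ¬ α.Sat _ _ (Function.update g x t)})
      hS hs fun X t ht => not_congr ?_
    exact ih (.inr (hα.resolve_left id)) _ _ ((hS.assign_range X).assign_var x _)
      (hnode x t (hnode' X hs)) (hbinder ht (hrange X hg))

theorem mem_free_toMSO {Φ : A → MSO} {q : ℕ} : ∀ {α : OneStep A}, q ∈ (α.toMSO M Φ).free →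
    q = nodeLetter M ∨ (∃ x ∈ α.free, q = varLetter M x) ∨ ∃ a, q ∈ (Φ a).free := by
  have hpred : ∀ {a : A} {x : ℕ}, q ∈ (MSO.exNode M (nodeLetter M)
      (.and (.sub (nodeLetter M) (varLetter M x)) (Φ a))).free →
      q = nodeLetter M ∨ (∃ y ∈ ({x} : Set ℕ), q = varLetter M y) ∨ ∃ a, q ∈ (Φ a).free := by
    intro a x h
    obtain ⟨(h₁ | h₁) | h₁, h₂⟩ := MSO.mem_free_exNode h
    · exact .inl h₁
    · exact .inr (.inl ⟨x, rfl, h₁⟩)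
    · exact .inr (.inr ⟨a, h₁⟩)
  have hbin : ∀ {F G : Set ℕ},
      (q = nodeLetter M ∨ (∃ x ∈ F, q = varLetter M x) ∨ ∃ a, q ∈ (Φ a).free) ∨
      (q = nodeLetter M ∨ (∃ x ∈ G, q = varLetter M x) ∨ ∃ a, q ∈ (Φ a).free) →
      q = nodeLetter M ∨ (∃ x ∈ F ∪ G, q = varLetter M x) ∨ ∃ a, q ∈ (Φ a).free := by
    rintro F G (h | h)
    · exact h.imp_right (Or.imp_left fun ⟨x, hx, h⟩ => ⟨x, .inl hx, h⟩)
    · exact h.imp_right (Or.imp_left fun ⟨x, hx, h⟩ => ⟨x, .inr hx, h⟩)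
  have hquant : ∀ {F G : Set ℕ} {x : ℕ},
      (q ∈ G → q = nodeLetter M ∨ (∃ y ∈ F, q = varLetter M y) ∨ ∃ a, q ∈ (Φ a).free) →
      q = nodeLetter M ∨ q ∈ G ∧ q ≠ varLetter M x →
      q = nodeLetter M ∨ (∃ y ∈ F \ {x}, q = varLetter M y) ∨ ∃ a, q ∈ (Φ a).free := by
    rintro F G x ih (h | ⟨h, hne⟩)
    · exact .inl h
    · refine (ih h).imp_right (Or.imp_left fun ⟨y, hy, h⟩ => ⟨y, ⟨hy, ?_⟩, h⟩)
      rintro rfl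
      exact hne h
  intro α
  induction α with
  | pred a x => exact hpred
  | npred a x => exact hpred
  | eq x y => exact fun h => .inr (.inl (h.elim (⟨x, .inl rfl, ·⟩) (⟨y, .inr rfl, ·⟩)))
  | neq x y => exact fun h => .inr (.inl (h.elim (⟨x, .inl rfl, ·⟩) (⟨y, .inr rfl, ·⟩)))
  | or α β iha ihb => exact fun h => hbin (h.imp iha ihb)
  | and α β iha ihb => exact fun h => hbin (h.imp iha ihb)
  | ex x α ih => exact fun h => hquant ih (MSO.mem_free_exSucc h)
  | all x α ih => exact fun h => hquant ih (MSO.mem_free_exSucc h)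
  | exInf x α ih => exact fun h => hquant ih (MSO.mem_free_cover h)
  | allInf x α ih => exact fun h => hquant ih (MSO.mem_free_cover h)

theorem le_bound_toMSO {Φ : A → MSO} (hΦ : ∀ a, ∀ q ∈ (Φ a).bound, M ≤ q) (α : OneStep A) :
    ∀ q ∈ (α.toMSO M Φ).bound, M ≤ q := by
  induction α with
  | pred a x => exact MSO.le_bound_exNode le_rfl fun q hq => Or.elim hq False.elim (hΦ a q)
  | npred a x => exact MSO.le_bound_exNode le_rfl fun q hq => Or.elim hq False.elim (hΦ a q)
  | eq x y => exact fun _ h => False.elim h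
  | neq x y => exact fun _ h => False.elim h
  | or α β iha ihb => exact fun q h => h.elim (iha q) (ihb q)
  | and α β iha ihb => exact fun q h => h.elim (iha q) (ihb q)
  | ex x α ih => exact MSO.le_bound_exSucc ih
  | all x α ih => exact MSO.le_bound_exSucc ih
  | exInf x α ih => exact MSO.le_bound_cover ih
  | allInf x α ih => exact MSO.le_bound_cover ih

end OneStep

/-! ### The translation of fixpoint formulas -/

namespace MuFormula

variable {K : LTS T → Set T → Prop} {L : OneStepLang} {φ : MuFormula} {M : ℕ}

/-- The current node satisfies the letter `q`, given the innermost operator that binds `q`: none, a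
least fixpoint (`some true`), or a greatest fixpoint (`some false`). In the last case the new letter
denotes the complement. -/
def letterToMSO (M q : ℕ) : Option Bool → MSO
  | none => .sub (nodeLetter M) q
  | some true => .sub (nodeLetter M) (fixLetter M q)
  | some false => .neg (.sub (nodeLetter M) (fixLetter M q))

/-- The translation of a formula at the current node, where `σ` records which operators bind the
letters in the context. -/
def toMSO (M : ℕ) : MuFormula → (ℕ → Option Bool) → MSO
  | letter q, σ => letterToMSO M q (σ q)
  | nletter q, σ => .neg (letterToMSO M q (σ q))
  | or φ ψ, σ => .or (φ.toMSO M σ) (ψ.toMSO M σ)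
  | and φ ψ, σ => .and (φ.toMSO M σ) (ψ.toMSO M σ)
  | nxt α φ, σ => α.toMSO M fun i => (φ i).toMSO M σ
  | mu p φ, σ => .lfp M p (φ.toMSO M (Function.update σ p (some true)))
  | nu p φ, σ => .neg (.lfp M p (.neg (φ.toMSO M (Function.update σ p (some false)))))

/-- The translation. The code of `φ` bounds the letters of `φ`, so that larger letters are fresh. -/
def translate (φ : MuFormula) : MSO :=
  .exNode (φ.code + 1) (nodeLetter (φ.code + 1))
    (.and (.here (nodeLetter (φ.code + 1))) (φ.toMSO (φ.code + 1) fun _ => none))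

/-- The conditions on the subformulas under which the translation preserves truth. -/
def Translatable (K : LTS T → Set T → Prop) : MuFormula → Prop
  | letter _ => True
  | nletter _ => True
  | or φ ψ => φ.Translatable K ∧ ψ.Translatable K
  | and φ ψ => φ.Translatable K ∧ ψ.Translatable K
  | nxt α φ => α.free = ∅ ∧ (α.FirstOrder ∨ ∀ S X, K S X ↔ X.Finite) ∧ ∀ i, (φ i).Translatable K
  | mu p φ => φ.Translatable K ∧ MuRestricts K p φ
  | nu p φ => φ.Translatable K ∧ NuRestricts K p φ

/-- The set denoted by the letter `q` of the source formula in a system for the target formula. -/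
def letterVal (M : ℕ) (S : LTS T) (q : ℕ) : Option Bool → Set T
  | none => S.val q
  | some true => S.val (fixLetter M q)
  | some false => (S.val (fixLetter M q))ᶜ

/-- `S'` is a system for a source formula with free letters `F` in the context `σ`, as described by
the system `S` for the target formula. -/
def Interprets (M : ℕ) (σ : ℕ → Option Bool) (F : Set ℕ) (S' S : LTS T) : Prop :=
  S'.rel = S.rel ∧ ∀ q ∈ F, S'.val q = letterVal M S q (σ q) ∧ (σ q = none → q < M)

theorem Interprets.mono {σ : ℕ → Option Bool} {F F' : Set ℕ} {S S' : LTS T}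
    (h : Interprets M σ F S' S) (hF : F' ⊆ F) : Interprets M σ F' S' S :=
  ⟨h.1, fun q hq => h.2 q (hF hq)⟩

theorem Interprets.agree {σ : ℕ → Option Bool} {F : Set ℕ} {S S' S'' : LTS T}
    (h : Interprets M σ F S' S) (hS : OneStep.Agree M S S'') : Interprets M σ F S' S'' := by
  refine ⟨h.1.trans hS.1, fun q hq => ⟨?_, (h.2 q hq).2⟩⟩
  rw [(h.2 q hq).1]
  have hfix := hS.2 (fixLetter M q) (.inr ⟨q, rfl⟩)
  have hlt := (h.2 q hq).2
  revert hlt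
  rcases σ q with _ | _ | _
  · exact fun hlt => hS.2 q (.inl (hlt rfl))
  · exact fun _ => congrArg (fun X : Set T => Xᶜ) hfix
  · exact fun _ => hfix

theorem Interprets.binder {σ : ℕ → Option Bool} {F : Set ℕ} {p : ℕ} {S S' : LTS T}
    (h : Interprets M σ (F \ {p}) S' S) (b : Bool) (X P : Set T) (t : T) :
    Interprets M (Function.update σ p (some b)) F (S'.assign p (bif b then P else Pᶜ))
      (((S.assign (rangeLetter M) X).assign (fixLetter M p) P).assign (nodeLetter M) {t}) := by
  refine ⟨h.1, fun q hq => ?_⟩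
  have hfix : ∀ r, (((S.assign (rangeLetter M) X).assign (fixLetter M p) P).assign
      (nodeLetter M) {t}).val (fixLetter M r) = if r = p then P else S.val (fixLetter M r) := by
    intro r
    rw [LTS.val_assign_of_ne _ (fixLetter_ne_nodeLetter M r)]
    split_ifs with hr
    · rw [hr, LTS.val_assign_self]
    · rw [LTS.val_assign_of_ne _ ((fixLetter_injective M).ne hr),
        LTS.val_assign_of_ne _ (fixLetter_ne_rangeLetter M r)]
  by_cases hqp : q = p
  · subst hqp
    rw [LTS.val_assign_self, Function.update_self]
    cases b <;> simp [letterVal, hfix]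
  · rw [LTS.val_assign_of_ne _ hqp, Function.update_of_ne hqp, (h.2 q ⟨hq, hqp⟩).1]
    have hlt := (h.2 q ⟨hq, hqp⟩).2
    refine ⟨?_, hlt⟩
    revert hlt
    rcases σ q with _ | _ | _
    · intro hlt
      have := hlt rfl
      simp only [letterVal]
      rw [LTS.val_assign_of_ne _ (by simp only [nodeLetter]; omega),
        LTS.val_assign_of_ne _ (by simp only [fixLetter]; omega),
        LTS.val_assign_of_ne _ (by simp only [rangeLetter]; omega)]
    · intro _; simp only [letterVal, hfix, if_neg hqp]
    · intro _; simp only [letterVal, hfix, if_neg hqp]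

theorem sat_letterToMSO {S : LTS T} {s : T} (hs : S.val (nodeLetter M) = {s}) (q : ℕ)
    (o : Option Bool) : (letterToMSO M q o).Sat K S ↔ s ∈ letterVal M S q o := by
  rcases o with _ | _ | _ <;> simp [letterToMSO, letterVal, hs]

theorem sat_toMSO (hK : Admissible K) : ∀ {φ : MuFormula}, φ.Translatable K →
    ∀ (σ : ℕ → Option Bool) (S S' : LTS T) (s : T), Interprets M σ φ.free S' S →
      S.val (nodeLetter M) = {s} → ((φ.toMSO M σ).Sat K S ↔ s ∈ φ.ext S') := by
  intro φ
  induction φ with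
  | letter q =>
    intro _ σ S S' s hS hs
    rw [toMSO, sat_letterToMSO hs, ← (hS.2 q rfl).1]
    rfl
  | nletter q =>
    intro _ σ S S' s hS hs
    rw [toMSO, MSO.sat_neg, sat_letterToMSO hs, ← (hS.2 q rfl).1]
    rfl
  | or φ ψ ih₁ ih₂ =>
    intro h σ S S' s hS hs
    exact or_congr (ih₁ h.1 σ S S' s (hS.mono Set.subset_union_left) hs)
      (ih₂ h.2 σ S S' s (hS.mono Set.subset_union_right) hs)
  | and φ ψ ih₁ ih₂ =>
    intro h σ S S' s hS hs
    rw [toMSO, MSO.sat_and]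
    exact and_congr (ih₁ h.1 σ S S' s (hS.mono Set.subset_union_left) hs)
      (ih₂ h.2 σ S S' s (hS.mono Set.subset_union_right) hs)
  | nxt α φ ih =>
    intro h σ S S' s hS hs
    have hsucc : S'.succ s = S.succ s := by simp only [LTS.succ, hS.1]
    rw [toMSO, OneStep.sat_toMSO hK s (W := fun i => (φ i).ext S') (S₀ := S) ?_ h.2.1 S
      (fun _ => s) ⟨rfl, fun _ _ => rfl⟩ hs fun x hx => by simp [h.1] at hx]
    · rw [← hsucc]
      rfl
    · exact fun i S'' t hS'' ht => ih i (h.2.2 i) σ S'' S' t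
        ((hS.mono (Set.subset_iUnion (fun i => (φ i).free) i)).agree hS'') ht
  | mu p φ ih =>
    intro h σ S S' s hS hs
    rw [toMSO, MSO.sat_lfp hK hs, h.2]
    refine exists_congr fun X => and_congr ⟨hK.congr hS.1.symm, hK.congr hS.1⟩ ?_
    refine forall₂_congr fun P hP => imp_congr ?_ Iff.rfl
    have key := fun t => ih h.1 _ _ _ t (hS.binder true X P t) (LTS.val_assign_self ..)
    simp only [key, cond_true]
    exact ⟨fun h t ht => h t ht.2 ht.1, fun h t ht ht' => h ⟨ht', ht⟩⟩
  | nu p φ ih =>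
    intro h σ S S' s hS hs
    rw [toMSO, MSO.sat_neg, ← not_iff_comm, h.2, MSO.sat_lfp hK hs]
    refine exists_congr fun X => and_congr ⟨hK.congr hS.1, hK.congr hS.1.symm⟩ ?_
    refine forall₂_congr fun P hP => imp_congr ?_ Iff.rfl
    have key := fun t => ih h.1 _ _ _ t (hS.binder false X P t) (LTS.val_assign_self ..)
    simp only [MSO.sat_neg, key, cond_false]
    exact ⟨fun h t ht ht' => h ⟨ht', ht⟩, fun h t ht => h t ht.2 ht.1⟩

theorem le_bound_toMSO (φ : MuFormula) :
    ∀ σ, ∀ q ∈ (φ.toMSO M σ).bound, M ≤ q := by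
  have hletter : ∀ r o, ∀ q ∈ (letterToMSO M r o).bound, M ≤ q := by
    rintro r (_ | _ | _) q hq <;> exact False.elim hq
  induction φ with
  | letter r => exact fun σ => hletter r _
  | nletter r => exact fun σ => hletter r _
  | or φ ψ ih₁ ih₂ => exact fun σ q h => Or.elim h (ih₁ σ q) (ih₂ σ q)
  | and φ ψ ih₁ ih₂ => exact fun σ q h => Or.elim h (ih₁ σ q) (ih₂ σ q)
  | nxt α φ ih => exact fun σ => OneStep.le_bound_toMSO (fun i => ih i σ) α
  | mu p φ ih => exact fun σ => MSO.le_bound_lfp (ih _)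
  | nu p φ ih => exact fun σ => MSO.le_bound_lfp (φ := .neg _) (ih _)

/-- The modal clause needs `α` to be a sentence, since no letter is quantified for a free individual
variable of `α`. -/
theorem Mu.mem_free_toMSO (h : Mu L φ) : ∀ {σ : ℕ → Option Bool} {q : ℕ},
    q ∈ (φ.toMSO M σ).free → q = nodeLetter M ∨
      ∃ r ∈ φ.free, (σ r = none ∧ q = r) ∨ (σ r ≠ none ∧ q = fixLetter M r) := by
  have hletter : ∀ {o : Option Bool} {r q : ℕ}, q ∈ (letterToMSO M r o).free →
      q = nodeLetter M ∨ (o = none ∧ q = r) ∨ (o ≠ none ∧ q = fixLetter M r) := by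
    rintro (_ | _ | _) r q (hq | hq)
    · exact .inl hq
    · exact .inr (.inl ⟨rfl, hq⟩)
    · exact .inl hq
    · exact .inr (.inr ⟨by simp, hq⟩)
    · exact .inl hq
    · exact .inr (.inr ⟨by simp, hq⟩)
  have hbinder : ∀ {F : Set ℕ} {σ : ℕ → Option Bool} {p q : ℕ} {b : Bool} {ψ : MSO},
      (q ∈ ψ.free → q = nodeLetter M ∨ ∃ r ∈ F, (Function.update σ p (some b) r = none ∧ q = r) ∨
        (Function.update σ p (some b) r ≠ none ∧ q = fixLetter M r)) →
      q ∈ (MSO.lfp M p ψ).free → q = nodeLetter M ∨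
        ∃ r ∈ F \ {p}, (σ r = none ∧ q = r) ∨ (σ r ≠ none ∧ q = fixLetter M r) := by
    intro F σ p q b ψ ih hq
    rcases MSO.mem_free_lfp hq with hq | ⟨hq, hne⟩
    · exact .inl hq
    refine (ih hq).imp_right fun ⟨r, hr, h⟩ => ?_
    have hrp : r ≠ p := by
      rintro rfl
      simp only [Function.update_self, reduceCtorEq, false_and, false_or] at h
      exact hne h.2
    rw [Function.update_of_ne hrp] at h
    exact ⟨r, ⟨hr, hrp⟩, h⟩
  induction h with
  | letter r => exact fun hq => (hletter hq).imp_right fun h => ⟨r, rfl, h⟩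
  | nletter r => exact fun hq => (hletter hq).imp_right fun h => ⟨r, rfl, h⟩
  | or _ _ ih₁ ih₂ =>
    rintro σ q (hq | hq)
    · exact (ih₁ hq).imp_right fun ⟨r, hr, h⟩ => ⟨r, .inl hr, h⟩
    · exact (ih₂ hq).imp_right fun ⟨r, hr, h⟩ => ⟨r, .inr hr, h⟩
  | and _ _ ih₁ ih₂ =>
    rintro σ q (hq | hq)
    · exact (ih₁ hq).imp_right fun ⟨r, hr, h⟩ => ⟨r, .inl hr, h⟩
    · exact (ih₂ hq).imp_right fun ⟨r, hr, h⟩ => ⟨r, .inr hr, h⟩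
  | nxt hα _ ih =>
    intro σ q hq
    rcases OneStep.mem_free_toMSO hq with hq | ⟨x, hx, -⟩ | ⟨i, hq⟩
    · exact .inl hq
    · simp [hα.2.2] at hx
    · exact (ih i hq).imp_right fun ⟨r, hr, h⟩ => ⟨r, Set.mem_iUnion.2 ⟨i, hr⟩, h⟩
  | mu _ _ ih => exact fun hq => hbinder ih hq
  | nu _ _ ih => exact fun hq => hbinder (ψ := .neg _) ih hq

theorem lt_encode_of_mem {l : List ℕ} {n : ℕ} (h : n ∈ l) : n < Encodable.encode l := by
  induction l with
  | nil => simp at h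
  | cons m l ih =>
    rw [Encodable.encode_list_cons, Nat.lt_succ_iff]
    rcases List.mem_cons.1 h with rfl | h
    · exact Nat.left_le_pair _ _
    · exact (ih h).le.trans (Nat.right_le_pair _ _)

theorem le_code_of_mem_free {φ : MuFormula} {q : ℕ} (h : q ∈ φ.free) : q ≤ φ.code := by
  induction φ with
  | letter r => exact (show q = r from h).le.trans (Nat.right_le_pair _ _)
  | nletter r => exact (show q = r from h).le.trans (Nat.right_le_pair _ _)
  | or φ ψ ih₁ ih₂ =>
    refine (Or.elim h (fun h => (ih₁ h).trans ?_) (fun h => (ih₂ h).trans ?_)).trans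
      (Nat.right_le_pair 2 (Nat.pair φ.code ψ.code))
    · exact Nat.left_le_pair _ _
    · exact Nat.right_le_pair _ _
  | and φ ψ ih₁ ih₂ =>
    refine (Or.elim h (fun h => (ih₁ h).trans ?_) (fun h => (ih₂ h).trans ?_)).trans
      (Nat.right_le_pair 3 (Nat.pair φ.code ψ.code))
    · exact Nat.left_le_pair _ _
    · exact Nat.right_le_pair _ _
  | nxt α φ ih =>
    obtain ⟨i, hi⟩ := Set.mem_iUnion.1 h
    have hmem : (φ i).code ∈ List.ofFn fun i => (φ i).code := List.mem_ofFn.2 ⟨i, rfl⟩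
    refine (ih i hi).trans ((lt_encode_of_mem hmem).le.trans ?_)
    exact ((Nat.right_le_pair _ _).trans (Nat.right_le_pair _ _)).trans (Nat.right_le_pair _ _)
  | mu p φ ih => exact ((ih h.1).trans (Nat.right_le_pair _ _)).trans (Nat.right_le_pair _ _)
  | nu p φ ih => exact ((ih h.1).trans (Nat.right_le_pair _ _)).trans (Nat.right_le_pair _ _)

theorem Mu.properTarget (h : Mu L φ) : ProperTarget translate φ := by
  have hfree : (translate φ).free ⊆ φ.free := by
    intro q hq
    obtain ⟨hq | hq, hne⟩ := MSO.mem_free_exNode hq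
    · exact (hne hq).elim
    · obtain hq | ⟨r, hr, ⟨-, rfl⟩ | ⟨h', -⟩⟩ := h.mem_free_toMSO hq
      · exact (hne hq).elim
      · exact hr
      · exact (h' rfl).elim
  refine ⟨Set.disjoint_left.2 fun q hq hq' => ?_, hfree⟩
  have h₁ := le_code_of_mem_free (hfree hq)
  have h₂ : φ.code + 1 ≤ q := by
    refine MSO.le_bound_exNode (M := φ.code + 1) le_rfl (fun q hq => ?_) q hq'
    exact Or.elim hq False.elim (le_bound_toMSO φ _ q)
  omega

theorem Translatable.sat_translate (hK : Admissible K) (h : φ.Translatable K) (S : LTS T) :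
    φ.Sat S ↔ (translate φ).Sat K S := by
  rw [translate, MSO.sat_exNode_nodeLetter hK]
  have key := fun s => sat_toMSO hK h (fun _ => none)
    (S.assign (nodeLetter (φ.code + 1)) {s}) S s ⟨rfl, fun q hq => ⟨?_, fun _ =>
      Nat.lt_succ_of_le (le_code_of_mem_free hq)⟩⟩ (LTS.val_assign_self ..)
  · simp only [MSO.sat_and, key]
    simp only [MSO.Sat, LTS.val_assign_self]
    constructor
    · exact fun hS => ⟨S.root, rfl, hS⟩
    · rintro ⟨s, hs, h⟩
      rwa [Set.singleton_eq_singleton_iff.1 hs] at h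
  · have := le_code_of_mem_free hq
    exact (LTS.val_assign_of_ne _ (by simp only [nodeLetter]; omega) _).symm

theorem isTranslation {D : MuFormula → Prop} {K : ∀ T : Type u, LTS T → Set T → Prop}
    (hK : ∀ T, Admissible (K T)) (hD : ∀ φ, D φ → Mu L φ ∧ ∀ T, φ.Translatable (K T))
    (hmu : ∀ p φ, D (mu p φ) → D φ) : IsTranslation D K translate := by
  refine ⟨fun φ hφ => ⟨(hD φ hφ).1.properTarget,
    fun T S => ((hD φ hφ).2 T).sat_translate (hK T) S⟩, fun p φ hφ T S => ?_⟩
  have hφ' := hD φ (hmu p φ hφ)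
  rw [← ((hD _ hφ).2 T).sat_translate (hK T) S, MuFormula.Sat, ((hD _ hφ).2 T).2]
  have key : ∀ P : Set T,
      {w | (translate φ).Sat (K T) ((S.assign p P).atNode w)} = φ.ext (S.assign p P) := by
    intro P
    ext w
    rw [Set.mem_ofPred_eq, ← (hφ'.2 T).sat_translate (hK T), MuFormula.Sat,
      hφ'.1.ext_congr (S := (S.assign p P).atNode w) (S' := S.assign p P) rfl fun _ _ => rfl]
    rfl
  simp only [key]

theorem MuD.translatable (h : MuD .foe φ) {K : LTS T → Set T → Prop} (hK : Admissible K)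
    (hG : ∀ S s X, Grounded S.rel s X → K S X) : φ.Translatable K := by
  have hfo : ∀ {n : ℕ} {α : OneStep (Fin n)}, α ∈ OneStep.Pos .foe → α.FirstOrder := fun hα =>
    hα.1.resolve_left (by simp)
  induction h with
  | letter q => trivial
  | nletter q => trivial
  | or _ _ ih₁ ih₂ => exact ⟨ih₁, ih₂⟩
  | and _ _ ih₁ ih₂ => exact ⟨ih₁, ih₂⟩
  | nxt hα _ ih => exact ⟨hα.2.2, .inl (hfo hα), ih⟩
  | mu h hp ih =>
    exact ⟨ih, Localizes.muRestricts (G := fun S => Grounded S.rel)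
      (fun S => Grounded.basedFamily S.rel) hG (fun _ => hp.localizes) h.mu_formula
      (hp.mu_positiveIn.2 _ rfl)⟩
  | nu h hp ih =>
    refine ⟨ih, MuRestricts.nuRestricts hK.congr (MuD.nu h hp).mu_formula ?_⟩
    exact Localizes.muRestricts (G := fun S => Grounded S.rel)
      (fun S => Grounded.basedFamily S.rel) hG (fun _ => hp.dual.localizes) h.mu_formula.dual
      (hp.dual.mu_positiveIn.2 _ rfl)

theorem MuC.translatable (h : MuC L φ) :
    φ.Translatable fun (_ : LTS T) (X : Set T) => X.Finite := by
  induction h with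
  | letter q => trivial
  | nletter q => trivial
  | or _ _ ih₁ ih₂ => exact ⟨ih₁, ih₂⟩
  | and _ _ ih₁ ih₂ => exact ⟨ih₁, ih₂⟩
  | nxt hα _ ih => exact ⟨hα.2.2, .inr fun _ _ => Iff.rfl, ih⟩
  | mu h hp ih =>
    exact ⟨ih, Localizes.muRestricts (G := fun _ _ X => X.Finite) (fun _ => basedFamily_finite)
      (fun _ _ _ => id) (fun _ => hp.localizes) h.mu_formula (hp.mu_positiveIn.2 _ rfl)⟩
  | nu h hp ih =>
    refine ⟨ih, MuRestricts.nuRestricts (fun _ _ => id) (MuC.nu h hp).mu_formula ?_⟩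
    exact Localizes.muRestricts (G := fun _ _ X => X.Finite) (fun _ => basedFamily_finite)
      (fun _ _ _ => id) (fun _ => hp.dual.localizes) h.mu_formula.dual
      (hp.dual.mu_positiveIn.2 _ rfl)

end MuFormula

theorem admissible_finite : Admissible fun (_ : LTS T) (X : Set T) => X.Finite :=
  ⟨fun _ _ => id, fun h h' => Set.Finite.subset h h', fun _ => Set.finite_singleton⟩

theorem admissible_wfNoetherian : Admissible fun (S : LTS T) (X : Set T) => S.WfNoetherian X where
  congr := by
    rintro ⟨R, _, _⟩ ⟨_, _, _⟩ rfl X h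
    exact h
  subset := fun ⟨B, hB, hcl, hcov⟩ hYX => ⟨B, hB, hcl, fun t ht => hcov t (hYX ht)⟩
  singleton S s := (Grounded.singleton s).wfNoetherian S

theorem admissible_noetherian : Admissible fun (S : LTS T) (X : Set T) => S.Noetherian X where
  congr := by
    rintro ⟨R, _, _⟩ ⟨_, _, _⟩ rfl X h
    exact h
  subset := fun ⟨B, hB, hcov⟩ hYX => ⟨B, hB, fun t ht => hcov t (hYX ht)⟩
  singleton S s := ((Grounded.singleton s).wfNoetherian S).noetherian

/-! ### Effectiveness -/

/-- A definition by recursion along a measure, with a list of recursive calls, yields a primitive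
recursive function if its ingredients are primitive recursive. -/
theorem exists_primrec_fix {β : Type} [Primcodable β] {m : β → ℕ} {l : β → List β}
    {g : β → List ℕ → ℕ} (hm : Primrec m) (hl : Primrec l) (hg : Primrec₂ g)
    (hlt : ∀ b, ∀ b' ∈ l b, m b' < m b) :
    ∃ f : β → ℕ, Primrec f ∧ ∀ b, f b = g b ((l b).map f) := by
  let F : ∀ b, (∀ b', m b' < m b → ℕ) → ℕ := fun b rec =>
    g b ((l b).attach.map fun b' => rec b'.1 (hlt b b'.1 b'.2))
  let f : β → ℕ := (measure m).wf.fix F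
  have hf : ∀ b, f b = g b ((l b).map f) := by
    intro b
    have h : f b = F b fun b' _ => f b' := (measure m).wf.fix_eq F b
    rw [h]
    simp only [F, List.map_attach_eq_pmap, List.pmap_eq_map]
  exact ⟨f, Primrec.nat_omega_rec' f hm hl (Primrec.option_some.comp₂ hg) hlt
    fun b => congrArg some (hf b).symm, hf⟩

namespace MSO

/-! ### Constructors and abbreviations of the target formulas on codes -/

def codeHere (p : ℕ) : ℕ := Nat.pair 0 p
def codeSub (p q : ℕ) : ℕ := Nat.pair 1 (Nat.pair p q)
def codeRel (p q : ℕ) : ℕ := Nat.pair 2 (Nat.pair p q)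
def codeNeg (a : ℕ) : ℕ := Nat.pair 3 a
def codeOr (a b : ℕ) : ℕ := Nat.pair 4 (Nat.pair a b)
def codeEx (p a : ℕ) : ℕ := Nat.pair 5 (Nat.pair p a)
def codeAnd (a b : ℕ) : ℕ := codeNeg (codeOr (codeNeg a) (codeNeg b))
def codeAll (p a : ℕ) : ℕ := codeNeg (codeEx p (codeNeg a))

def codeSing (M x : ℕ) : ℕ :=
  codeAnd (codeNeg (codeAll (M + 2) (codeSub x (M + 2))))
    (codeAll (M + 2) (codeOr (codeNeg (codeSub (M + 2) x))
      (codeOr (codeSub x (M + 2)) (codeAll (M + 3) (codeSub (M + 2) (M + 3))))))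

def codeExNode (M x a : ℕ) : ℕ := codeEx x (codeAnd (codeSing M x) a)

def codeExSucc (M x a : ℕ) : ℕ :=
  codeExNode M (varLetter M x) (codeAnd (codeRel (nodeLetter M) (varLetter M x)) a)

def codeCover (M x a : ℕ) : ℕ :=
  codeEx (rangeLetter M)
    (codeNeg (codeExSucc M x (codeAnd a (codeNeg (codeSub (varLetter M x) (rangeLetter M))))))

def codeLfp (M p a : ℕ) : ℕ :=
  codeEx (rangeLetter M) (codeAll (fixLetter M p)
    (codeOr (codeNeg (codeSub (fixLetter M p) (rangeLetter M)))
      (codeOr (codeExNode M (nodeLetter M) (codeAnd (codeSub (nodeLetter M) (rangeLetter M))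
          (codeAnd a (codeNeg (codeSub (nodeLetter M) (fixLetter M p))))))
        (codeSub (nodeLetter M) (fixLetter M p)))))

end MSO

section Primrec

variable {α : Type} [Primcodable α] {f g h : α → ℕ}

open MSO

theorem primrec_add_const (hf : Primrec f) (k : ℕ) : Primrec fun a => f a + k :=
  Primrec.nat_add.comp hf (.const k)

theorem primrec_nodeLetter (hf : Primrec f) : Primrec fun a => nodeLetter (f a) := hf

theorem primrec_rangeLetter (hf : Primrec f) : Primrec fun a => rangeLetter (f a) :=
  primrec_add_const hf 1

theorem primrec_fixLetter (hf : Primrec f) (hg : Primrec g) :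
    Primrec fun a => fixLetter (f a) (g a) :=
  Primrec.nat_add.comp (primrec_add_const hf 4) (Primrec.nat_mul.comp (.const 2) hg)

theorem primrec_varLetter (hf : Primrec f) (hg : Primrec g) :
    Primrec fun a => varLetter (f a) (g a) :=
  Primrec.nat_add.comp (primrec_add_const hf 5) (Primrec.nat_mul.comp (.const 2) hg)

theorem primrec_codeHere (hf : Primrec f) : Primrec fun a => codeHere (f a) :=
  Primrec₂.natPair.comp (.const 0) hf

theorem primrec_codeSub (hf : Primrec f) (hg : Primrec g) :
    Primrec fun a => codeSub (f a) (g a) :=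
  Primrec₂.natPair.comp (.const 1) (Primrec₂.natPair.comp hf hg)

theorem primrec_codeRel (hf : Primrec f) (hg : Primrec g) :
    Primrec fun a => codeRel (f a) (g a) :=
  Primrec₂.natPair.comp (.const 2) (Primrec₂.natPair.comp hf hg)

theorem primrec_codeNeg (hf : Primrec f) : Primrec fun a => codeNeg (f a) :=
  Primrec₂.natPair.comp (.const 3) hf

theorem primrec_codeOr (hf : Primrec f) (hg : Primrec g) : Primrec fun a => codeOr (f a) (g a) :=
  Primrec₂.natPair.comp (.const 4) (Primrec₂.natPair.comp hf hg)

theorem primrec_codeEx (hf : Primrec f) (hg : Primrec g) : Primrec fun a => codeEx (f a) (g a) :=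
  Primrec₂.natPair.comp (.const 5) (Primrec₂.natPair.comp hf hg)

theorem primrec_codeAnd (hf : Primrec f) (hg : Primrec g) :
    Primrec fun a => codeAnd (f a) (g a) :=
  primrec_codeNeg (primrec_codeOr (primrec_codeNeg hf) (primrec_codeNeg hg))

theorem primrec_codeAll (hf : Primrec f) (hg : Primrec g) :
    Primrec fun a => codeAll (f a) (g a) :=
  primrec_codeNeg (primrec_codeEx hf (primrec_codeNeg hg))

theorem primrec_codeSing (hf : Primrec f) (hg : Primrec g) :
    Primrec fun a => codeSing (f a) (g a) :=
  have h₂ := primrec_add_const hf 2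
  have h₃ := primrec_add_const hf 3
  primrec_codeAnd (primrec_codeNeg (primrec_codeAll h₂ (primrec_codeSub hg h₂)))
    (primrec_codeAll h₂ (primrec_codeOr (primrec_codeNeg (primrec_codeSub h₂ hg))
      (primrec_codeOr (primrec_codeSub hg h₂) (primrec_codeAll h₃ (primrec_codeSub h₂ h₃)))))

theorem primrec_codeExNode (hf : Primrec f) (hg : Primrec g) (hh : Primrec h) :
    Primrec fun a => codeExNode (f a) (g a) (h a) :=
  primrec_codeEx hg (primrec_codeAnd (primrec_codeSing hf hg) hh)

theorem primrec_codeExSucc (hf : Primrec f) (hg : Primrec g) (hh : Primrec h) :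
    Primrec fun a => codeExSucc (f a) (g a) (h a) :=
  have hx := primrec_varLetter hf hg
  primrec_codeExNode hf hx (primrec_codeAnd (primrec_codeRel (primrec_nodeLetter hf) hx) hh)

theorem primrec_codeCover (hf : Primrec f) (hg : Primrec g) (hh : Primrec h) :
    Primrec fun a => codeCover (f a) (g a) (h a) :=
  have hr := primrec_rangeLetter hf
  primrec_codeEx hr (primrec_codeNeg (primrec_codeExSucc hf hg (primrec_codeAnd hh
    (primrec_codeNeg (primrec_codeSub (primrec_varLetter hf hg) hr)))))

theorem primrec_codeLfp (hf : Primrec f) (hg : Primrec g) (hh : Primrec h) :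
    Primrec fun a => codeLfp (f a) (g a) (h a) :=
  have hr := primrec_rangeLetter hf
  have hn := primrec_nodeLetter hf
  have hp := primrec_fixLetter hf hg
  primrec_codeEx hr (primrec_codeAll hp (primrec_codeOr (primrec_codeNeg (primrec_codeSub hp hr))
    (primrec_codeOr (primrec_codeExNode hf hn (primrec_codeAnd (primrec_codeSub hn hr)
      (primrec_codeAnd hh (primrec_codeNeg (primrec_codeSub hn hp))))) (primrec_codeSub hn hp))))

theorem primrec_unpair_fst (hf : Primrec f) : Primrec fun a => (f a).unpair.1 :=
  Primrec.fst.comp (Primrec.unpair.comp hf)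

theorem primrec_unpair_snd (hf : Primrec f) : Primrec fun a => (f a).unpair.2 :=
  Primrec.snd.comp (Primrec.unpair.comp hf)

end Primrec

theorem unpair_snd_lt {n : ℕ} (h : n.unpair.1 ≠ 0) : n.unpair.2 < n := by
  have h₁ := Nat.add_le_pair n.unpair.1 n.unpair.2
  rw [Nat.pair_unpair] at h₁
  omega

namespace OneStep

open MSO

/-- The recursive calls for a code of a one-step formula, in a fixed context. -/
def codeCalls {γ : Type} (b : ℕ × γ) : List (ℕ × γ) :=
  if b.1.unpair.1 = 0 then [] else [(b.1.unpair.2.unpair.1, b.2), (b.1.unpair.2.unpair.2, b.2)]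

/-- The code of the translation of a one-step formula, from the results `l` of the recursive calls.
The context holds the bound `M` and the codes of the formulas that define the predicates. -/
def codeStep (b : ℕ × ℕ × List ℕ) (l : List ℕ) : ℕ :=
  let M := b.2.1
  let x := b.1.unpair.2.unpair.1
  let y := b.1.unpair.2.unpair.2
  let a := codeExNode M (nodeLetter M)
    (codeAnd (codeSub (nodeLetter M) (varLetter M y)) (b.2.2.getD x 0))
  let e := codeSub (varLetter M x) (varLetter M y)
  let u := l.getD 0 0
  let v := l.getD 1 0
  [a, codeNeg a, e, codeNeg e, codeOr u v, codeAnd u v, codeExSucc M x v,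
    codeNeg (codeExSucc M x (codeNeg v)), codeNeg (codeCover M x v),
    codeCover M x (codeNeg v)].getD b.1.unpair.1 0

theorem primrec_codeCalls {γ : Type} [Primcodable γ] : Primrec (codeCalls (γ := γ)) := by
  have hr := primrec_unpair_snd (Primrec.fst (α := ℕ) (β := γ))
  exact Primrec.ite (Primrec.eq.comp (primrec_unpair_fst Primrec.fst) (.const 0)) (.const [])
    (Primrec.list_cons.comp (Primrec.pair (primrec_unpair_fst hr) Primrec.snd)
      (Primrec.list_cons.comp (Primrec.pair (primrec_unpair_snd hr) Primrec.snd) (.const [])))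

theorem primrec_codeStep : Primrec₂ codeStep := by
  have hb : Primrec fun c : (ℕ × ℕ × List ℕ) × List ℕ => c.1 := Primrec.fst
  have hn := Primrec.fst.comp hb
  have hM := Primrec.fst.comp (Primrec.snd.comp hb)
  have hr := primrec_unpair_snd hn
  have hx := primrec_unpair_fst hr
  have hy := primrec_unpair_snd hr
  have ha := primrec_codeExNode hM (primrec_nodeLetter hM)
    (primrec_codeAnd (primrec_codeSub (primrec_nodeLetter hM) (primrec_varLetter hM hy))
      ((Primrec.list_getD 0).comp (Primrec.snd.comp (Primrec.snd.comp hb)) hx))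
  have he := primrec_codeSub (primrec_varLetter hM hx) (primrec_varLetter hM hy)
  have hl : Primrec fun c : (ℕ × ℕ × List ℕ) × List ℕ => c.2 := Primrec.snd
  have hu := (Primrec.list_getD 0).comp hl (.const 0)
  have hv := (Primrec.list_getD 0).comp hl (.const 1)
  have cons := fun {f : (ℕ × ℕ × List ℕ) × List ℕ → ℕ} {g} (hf : Primrec f) (hg : Primrec g) =>
    Primrec.list_cons.comp hf hg
  exact (Primrec.list_getD 0).comp (cons ha <| cons (primrec_codeNeg ha) <| cons he <|
    cons (primrec_codeNeg he) <| cons (primrec_codeOr hu hv) <| cons (primrec_codeAnd hu hv) <|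
    cons (primrec_codeExSucc hM hx hv) <|
    cons (primrec_codeNeg (primrec_codeExSucc hM hx (primrec_codeNeg hv))) <|
    cons (primrec_codeNeg (primrec_codeCover hM hx hv)) <|
    cons (primrec_codeCover hM hx (primrec_codeNeg hv)) (.const [])) (primrec_unpair_fst hn)

theorem exists_primrec_toMSO : ∃ f : ℕ × ℕ × List ℕ → ℕ, Primrec f ∧
    ∀ (M n : ℕ) (Φ : Fin n → MSO) (α : OneStep (Fin n)),
      f (α.code, M, List.ofFn fun i => (Φ i).code) = (α.toMSO M Φ).code := by
  obtain ⟨f, hf, hfix⟩ := exists_primrec_fix (m := Prod.fst) (l := codeCalls) Primrec.fst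
    primrec_codeCalls primrec_codeStep (by
      intro b b' hb'
      unfold codeCalls at hb'
      split_ifs at hb' with h
      · simp at hb'
      · have hlt := unpair_snd_lt h
        simp only [List.mem_cons, List.not_mem_nil, or_false] at hb'
        rcases hb' with rfl | rfl
        · exact (Nat.unpair_left_le _).trans_lt hlt
        · exact (Nat.unpair_right_le _).trans_lt hlt)
  refine ⟨f, hf, fun M n Φ α => ?_⟩
  induction α with
  | pred a x => rw [hfix]; simp [code, codeStep]; rfl
  | npred a x => rw [hfix]; simp [code, codeStep]; rfl
  | eq x y => rw [hfix]; simp [code, codeStep]; rfl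
  | neq x y => rw [hfix]; simp [code, codeStep]; rfl
  | or α β iha ihb => rw [hfix]; simp [code, codeStep, codeCalls, iha, ihb]; rfl
  | and α β iha ihb => rw [hfix]; simp [code, codeStep, codeCalls, iha, ihb]; rfl
  | ex x α ih => rw [hfix]; simp [code, codeStep, codeCalls, ih]; rfl
  | all x α ih => rw [hfix]; simp [code, codeStep, codeCalls, ih]; rfl
  | exInf x α ih => rw [hfix]; simp [code, codeStep, codeCalls, ih]; rfl
  | allInf x α ih => rw [hfix]; simp [code, codeStep, codeCalls, ih]; rfl

end OneStep

namespace MuFormula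

open MSO

/-- The context of the translation on codes: the bound `M`, and the list of the operators in scope,
the innermost first. -/
abbrev CodeContext : Type := ℕ × List (ℕ × Bool)

/-- The recursive calls for a code of a formula. -/
def codeCalls (b : ℕ × CodeContext) : List (ℕ × CodeContext) :=
  let r := b.1.unpair.2
  let two := [(r.unpair.1, b.2), (r.unpair.2, b.2)]
  [[], [], two, two,
    (Denumerable.ofNat (List ℕ) r.unpair.2.unpair.2).map fun n => (n, b.2),
    [(r.unpair.2, b.2.1, (r.unpair.1, true) :: b.2.2)],
    [(r.unpair.2, b.2.1, (r.unpair.1, false) :: b.2.2)]].getD b.1.unpair.1 []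

/-- `letterToMSO` on codes. -/
def codeLetter (M q : ℕ) (o : Option Bool) : ℕ :=
  o.casesOn (codeSub (nodeLetter M) q) fun b =>
    bif b then codeSub (nodeLetter M) (fixLetter M q)
    else codeNeg (codeSub (nodeLetter M) (fixLetter M q))

/-- The code of the translation of a formula, from the results `l` of the recursive calls, where `f`
is the translation of one-step formulas on codes. -/
def codeStep (f : ℕ × ℕ × List ℕ → ℕ) (b : ℕ × CodeContext) (l : List ℕ) : ℕ :=
  let M := b.2.1
  let r := b.1.unpair.2
  let q := codeLetter M r (b.2.2.lookup r)
  let u := l.getD 0 0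
  let v := l.getD 1 0
  [q, codeNeg q, codeOr u v, codeAnd u v, f (r.unpair.2.unpair.1, M, l),
    codeLfp M r.unpair.1 u,
    codeNeg (codeLfp M r.unpair.1 (codeNeg u))].getD b.1.unpair.1 0

theorem primrec_codeCalls : Primrec codeCalls := by
  have hc : Primrec fun b : ℕ × CodeContext => b.2 := Primrec.snd
  have hn : Primrec fun b : ℕ × CodeContext => b.1 := Primrec.fst
  have hr := primrec_unpair_snd hn
  have hr₁ := primrec_unpair_fst hr
  have hr₂ := primrec_unpair_snd hr
  have single := fun {f : ℕ × CodeContext → ℕ × CodeContext} (hf : Primrec f) =>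
    Primrec.list_cons.comp hf (.const [])
  have htwo := Primrec.list_cons.comp (Primrec.pair hr₁ hc) (single (Primrec.pair hr₂ hc))
  have hmap : Primrec fun b : ℕ × CodeContext =>
      (Denumerable.ofNat (List ℕ) b.1.unpair.2.unpair.2.unpair.2).map fun n => (n, b.2) :=
    Primrec.list_map ((Primrec.ofNat (List ℕ)).comp (primrec_unpair_snd hr₂))
      (Primrec₂.pair.comp₂ Primrec₂.right (hc.comp₂ Primrec₂.left))
  have hfix := fun o : Bool => single (Primrec.pair hr₂ (Primrec.pair (Primrec.fst.comp hc)
    (Primrec.list_cons.comp (Primrec.pair hr₁ (.const o)) (Primrec.snd.comp hc))))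
  have cons := fun {f : ℕ × CodeContext → List (ℕ × CodeContext)} {g} (hf : Primrec f)
    (hg : Primrec g) => Primrec.list_cons.comp hf hg
  exact (Primrec.list_getD []).comp (cons (.const []) <| cons (.const []) <| cons htwo <|
    cons htwo <| cons hmap <| cons (hfix true) <| cons (hfix false) (.const []))
    (primrec_unpair_fst hn)

theorem primrec_codeLetter {α : Type} [Primcodable α] {f g : α → ℕ} {o : α → Option Bool}
    (hf : Primrec f) (hg : Primrec g) (ho : Primrec o) :
    Primrec fun a => codeLetter (f a) (g a) (o a) := by
  have hs := primrec_codeSub (primrec_nodeLetter hf) (primrec_fixLetter hf hg)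
  refine Primrec.option_casesOn ho (primrec_codeSub (primrec_nodeLetter hf) hg) ?_
  exact Primrec.cond Primrec.snd (hs.comp Primrec.fst) ((primrec_codeNeg hs).comp Primrec.fst)

theorem primrec_codeStep {f : ℕ × ℕ × List ℕ → ℕ} (hf : Primrec f) : Primrec₂ (codeStep f) := by
  have hb : Primrec fun c : (ℕ × CodeContext) × List ℕ => c.1 := Primrec.fst
  have hn := Primrec.fst.comp hb
  have hM := Primrec.fst.comp (Primrec.snd.comp hb)
  have hr := primrec_unpair_snd hn
  have hp := primrec_unpair_fst hr
  have hq := primrec_codeLetter hM hr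
    (Primrec.listLookup.comp hr (Primrec.snd.comp (Primrec.snd.comp hb)))
  have hl : Primrec fun c : (ℕ × CodeContext) × List ℕ => c.2 := Primrec.snd
  have hu := (Primrec.list_getD 0).comp hl (.const 0)
  have hv := (Primrec.list_getD 0).comp hl (.const 1)
  have hnxt := hf.comp (Primrec.pair (primrec_unpair_fst (primrec_unpair_snd hr))
    (Primrec.pair hM hl))
  have cons := fun {f : (ℕ × CodeContext) × List ℕ → ℕ} {g} (hf : Primrec f) (hg : Primrec g) =>
    Primrec.list_cons.comp hf hg
  exact (Primrec.list_getD 0).comp (cons hq <| cons (primrec_codeNeg hq) <|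
    cons (primrec_codeOr hu hv) <| cons (primrec_codeAnd hu hv) <| cons hnxt <|
    cons (primrec_codeLfp hM hp hu) <|
    cons (primrec_codeNeg (primrec_codeLfp hM hp (primrec_codeNeg hu))) (.const []))
    (primrec_unpair_fst hn)

theorem fst_lt_of_mem_codeCalls (b b' : ℕ × CodeContext) (h : b' ∈ codeCalls b) : b'.1 < b.1 := by
  have key : ∀ k, k = b.1.unpair.1 → k ≠ 0 ∧ b'.1 ≤ b.1.unpair.2 := by
    intro k hk
    simp only [codeCalls, ← hk] at h
    have h₁ := Nat.unpair_left_le b.1.unpair.2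
    have h₂ := Nat.unpair_right_le b.1.unpair.2
    rcases k with _ | _ | _ | _ | _ | _ | _ | k <;>
      simp only [List.getD_cons_zero, List.getD_cons_succ, List.getD_nil, List.not_mem_nil,
        List.mem_cons, List.mem_map, or_false] at h
    · rcases h with rfl | rfl <;> simp [h₁, h₂]
    · rcases h with rfl | rfl <;> simp [h₁, h₂]
    · obtain ⟨n, hn, rfl⟩ := h
      have := lt_encode_of_mem hn
      rw [Denumerable.encode_ofNat] at this
      have h₃ := Nat.unpair_right_le b.1.unpair.2.unpair.2
      exact ⟨by omega, (this.le.trans h₃).trans h₂⟩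
    · subst h; simp [h₂]
    · subst h; simp [h₂]
  obtain ⟨h₁, h₂⟩ := key _ rfl
  exact h₂.trans_lt (unpair_snd_lt h₁)

theorem update_lookup (l : List (ℕ × Bool)) (p : ℕ) (o : Bool) :
    Function.update (fun q => l.lookup q) p (some o) = fun q => ((p, o) :: l).lookup q := by
  funext q
  by_cases h : q = p
  · subst h; simp
  · have : (q == p) = false := by simpa using h
    simp [h, List.lookup_cons, this]

theorem exists_primrec_toMSO : ∃ f : ℕ × CodeContext → ℕ, Primrec f ∧
    ∀ (φ : MuFormula) (M : ℕ) (l : List (ℕ × Bool)),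
      f (φ.code, M, l) = (φ.toMSO M fun q => l.lookup q).code := by
  obtain ⟨g, hg, hgcode⟩ := OneStep.exists_primrec_toMSO
  obtain ⟨f, hf, hfix⟩ := exists_primrec_fix (m := Prod.fst) (l := codeCalls) Primrec.fst
    primrec_codeCalls (primrec_codeStep hg) fst_lt_of_mem_codeCalls
  have hletter : ∀ M q o, codeLetter M q o = (letterToMSO M q o).code := by
    rintro M q (_ | _ | _) <;> rfl
  refine ⟨f, hf, fun φ => ?_⟩
  induction φ with
  | letter q => intro M l; rw [hfix]; simp [code, codeStep, hletter, toMSO]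
  | nletter q => intro M l; rw [hfix]; simp [code, codeStep, hletter, toMSO]; rfl
  | or φ ψ ih₁ ih₂ =>
    intro M l; rw [hfix]; simp [code, codeStep, codeCalls, ih₁, ih₂]; rfl
  | and φ ψ ih₁ ih₂ =>
    intro M l; rw [hfix]; simp [code, codeStep, codeCalls, ih₁, ih₂]; rfl
  | nxt α φ ih =>
    intro M l
    rw [hfix]
    simp [code, codeStep, codeCalls, List.map_ofFn, Function.comp_def, ih, hgcode, toMSO]
  | mu p φ ih =>
    intro M l
    rw [hfix]
    simp [code, codeStep, codeCalls, ih, toMSO, update_lookup]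
    rfl
  | nu p φ ih =>
    intro M l
    rw [hfix]
    simp [code, codeStep, codeCalls, ih, toMSO, update_lookup]
    rfl

theorem effectiveOn_translate (D : MuFormula → Prop) : EffectiveOn D translate := by
  obtain ⟨f, hf, hcode⟩ := exists_primrec_toMSO
  have hM : Primrec fun n : ℕ => n + 1 := primrec_add_const .id 1
  refine ⟨fun n => codeExNode (n + 1) (nodeLetter (n + 1))
    (codeAnd (codeHere (nodeLetter (n + 1))) (f (n, n + 1, []))), Primrec.to_comp ?_, ?_⟩
  · exact primrec_codeExNode hM (primrec_nodeLetter hM)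
      (primrec_codeAnd (primrec_codeHere (primrec_nodeLetter hM))
        (hf.comp (Primrec.pair .id (Primrec.pair hM (.const [])))))
  · intro φ _
    simp only [hcode]
    rfl

end MuFormula

end ModalMSO

open ModalMSO
theorem mainTheorem7 :
    (∃ t : MuFormula → MSO,
      EffectiveOn (MuFormula.MuD .foe) t ∧
      IsTranslation.{u} (MuFormula.MuD .foe) (fun _ S X => S.Noetherian X) t ∧
      IsTranslation.{u} (MuFormula.MuD .foe) (fun _ S X => S.WfNoetherian X) t) ∧
    (∃ t : MuFormula → MSO,
      EffectiveOn (MuFormula.MuC .foeInf) t ∧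
      IsTranslation.{u} (MuFormula.MuC .foeInf) (fun _ _ X => X.Finite) t) := by
  have hmuD : ∀ p φ, MuFormula.MuD .foe (.mu p φ) → MuFormula.MuD .foe φ := by
    rintro p φ ⟨⟩; assumption
  have hmuC : ∀ p φ, MuFormula.MuC .foeInf (.mu p φ) → MuFormula.MuC .foeInf φ := by
    rintro p φ ⟨⟩; assumption
  refine ⟨⟨MuFormula.translate, MuFormula.effectiveOn_translate _, ?_, ?_⟩,
    MuFormula.translate, MuFormula.effectiveOn_translate _, ?_⟩
  · exact MuFormula.isTranslation (fun _ => admissible_noetherian)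
      (fun φ hφ => ⟨hφ.mu_formula, fun _ => hφ.translatable admissible_noetherian
        fun S _ _ h => (h.wfNoetherian S).noetherian⟩) hmuD
  · exact MuFormula.isTranslation (fun _ => admissible_wfNoetherian)
      (fun φ hφ => ⟨hφ.mu_formula, fun _ => hφ.translatable admissible_wfNoetherian
        fun S _ _ h => h.wfNoetherian S⟩) hmuD
  · exact MuFormula.isTranslation (fun _ => admissible_finite)
      (fun φ hφ => ⟨hφ.mu_formula, fun _ => hφ.translatable⟩) hmuC
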